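/- Let $p$ be an odd prime and let $G$ be a pro-$p$ $p$-adic Lie group, with $G^{\mathrm{ab}} := G/[G,G]$. Let $\overline{\mathbb{Q}_p}$ be an algebraic closure of $\mathbb{Q}_p$, let $\mathcal{G}_p := \mathrm{Gal}(\overline{\mathbb{Q}_p}/\mathbb{Q}_p)$, and let $\mu_{p^\infty} \subseteq \overline{\mathbb{Q}_p}^\times$ be the group of all roots of unity of $p$-power order. Let $R_G$ be the representation ring of $G$, i.e. the Grothendieck ring (under $\oplus$ and $\otimes$) of finite-dimensional $\overline{\mathbb{Q}_p}$-representations of $G$ which are trivial on some open subgroup; $\mathcal{G}_p$ acts on it by conjugating matrix entries. Let $1_G \in R_G$ be the class of the trivial representation and let $I_G$ be the kernel of the augmentation $R_G \to \mathbb{Z}$, $[V] \mapsto \dim V$. Exterior powers give $R_G$ its $\lambda$-operations, with $\lambda_t(x) = \sum_n \lambda^n(x)t^n$, and $\gamma_t(x) = \sum_n \gamma^n(x) t^n := \lambda_{t/(1-t)}(x)$. Let $R_{G,2}$ be the second step of the $\gamma$-filtration, i.e. the additive subgroup of $R_G$ generated by all monomials $\gamma^{n_1}(x_1)\cdots\gamma^{n_k}(x_k)$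 with $x_1,\dots,x_k \in I_G$ and $n_1+\dots+n_k \geq 2$. For $g \in G$ let $\mathrm{DET}(g) : R_G \to \overline{\mathbb{Q}_p}^\times$ be the homomorphism $[V] \mapsto \det(g; V)$. Let $\psi^p : R_G \to R_G$ be the classical Adams operator, defined by $\sum_{k \geq 1} \psi^k(x)t^k = -t\,\frac{d}{dt}\log\lambda_{-t}(x)$; it satisfies $\mathrm{tr}(g;\psi^p x) = \mathrm{tr}(g^p; x)$ for all $g \in G$ and $x \in R_G$. Then: (i) The sum $\mathbb{Z}\cdot 1_G + R_{G,2}$ is direct, and $g \mapsto \mathrm{DET}(g)$ induces group isomorphisms $$G^{\mathrm{ab}} \xrightarrow{\;\cong\;} \mathrm{Hom}_{\mathcal{G}_p}\big(R_G/(\mathbb{Z}\cdot 1_G \oplus R_{G,2}), \mu_{p^\infty}\big) = \mathrm{Hom}_{\mathcal{G}_p}(I_G/R_{G,2}, \mu_{p^\infty}),$$ where the identification is given by restriction to $I_G$. (ii) $\mathrm{im}(p - \psi^p) \subseteq (p-1)\mathbb{Z}\cdot 1_G \oplus R_{G,2}$. -/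

import Mathlib

open scoped TensorProduct Manifold ContDiff

noncomputable section

universe u v

/-- A finite-dimensional `K`-linear representation of the topological group `G` which is trivial
on some open subgroup. -/
structure SmoothRep (K : Type u) [Field K] (G : Type v) [Group G] [TopologicalSpace G] where
  V : Type u
  [addCommGroup : AddCommGroup V]
  [module : Module K V]
  [finite : Module.Finite K V]
  ρ : Representation K G V
  smooth : ∃ U : OpenSubgroup G, ∀ g ∈ U, ρ g = 1

namespace SmoothRep

attribute [instance] SmoothRep.addCommGroup SmoothRep.module SmoothRep.finite

variable {K : Type u} [Field K] {G : Type v} [Group G] [TopologicalSpace G]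

/-- Isomorphism of representations. -/
instance setoid : Setoid (SmoothRep K G) where
  r A B := Nonempty (A.ρ.Equiv B.ρ)
  iseqv :=
    { refl := fun A => ⟨.refl A.ρ⟩
      symm := fun ⟨e⟩ => ⟨e.symm⟩
      trans := fun ⟨e⟩ ⟨f⟩ => ⟨e.trans f⟩ }

theorem equiv_of {A B : SmoothRep K G} (e : A.V ≃ₗ[K] B.V)
    (he : ∀ g, e.toLinearMap ∘ₗ A.ρ g = B.ρ g ∘ₗ e.toLinearMap) : A ≈ B :=
  ⟨.mk e he⟩

theorem exists_of_equiv {A B : SmoothRep K G} (h : A ≈ B) :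
    ∃ e : A.V ≃ₗ[K] B.V, ∀ g, e.toLinearMap ∘ₗ A.ρ g = B.ρ g ∘ₗ e.toLinearMap := by
  obtain ⟨e⟩ := h
  exact ⟨e.toLinearEquiv, fun g => LinearMap.ext fun x => e.toIntertwiningMap.isIntertwining _ _ g x⟩

/-- The zero representation. -/
def zero : SmoothRep K G where
  V := PUnit.{u + 1}
  ρ := 1
  smooth := ⟨⊤, fun _ _ => rfl⟩

/-- The one-dimensional trivial representation. -/
def one : SmoothRep K G where
  V := K
  ρ := Representation.trivial K G K
  smooth := ⟨⊤, fun _ _ => rfl⟩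

/-- Direct sum of representations. -/
def sum (A B : SmoothRep K G) : SmoothRep K G where
  V := A.V × B.V
  ρ := A.ρ.prod B.ρ
  smooth := by
    obtain ⟨U, hU⟩ := A.smooth
    obtain ⟨W, hW⟩ := B.smooth
    refine ⟨U ⊓ W, fun g hg => ?_⟩
    have h1 := hU g hg.1
    have h2 := hW g hg.2
    ext x <;> simp [h1, h2]

/-- Tensor product of representations, with diagonal action. -/
def tensor (A B : SmoothRep K G) : SmoothRep K G where
  V := A.V ⊗[K] B.V
  ρ := A.ρ.tprod B.ρ
  smooth := by
    obtain ⟨U, hU⟩ := A.smooth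
    obtain ⟨W, hW⟩ := B.smooth
    refine ⟨U ⊓ W, fun g hg => ?_⟩
    have h1 := hU g hg.1
    have h2 := hW g hg.2
    have h3 : TensorProduct.map (1 : A.V →ₗ[K] A.V) (1 : B.V →ₗ[K] B.V) = 1 :=
      TensorProduct.map_id
    rw [Representation.tprod_apply, h1, h2]
    exact h3

theorem exteriorPower_map_one (n : ℕ) (M : Type u) [AddCommGroup M] [Module K M] :
    exteriorPower.map n (1 : M →ₗ[K] M) = 1 :=
  exteriorPower.map_id

/-- The `n`-th exterior power of a representation. -/
def ext (n : ℕ) (A : SmoothRep K G) : SmoothRep K G where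
  V := ⋀[K]^n A.V
  ρ :=
    { toFun := fun g => exteriorPower.map n (A.ρ g)
      map_one' := by rw [map_one, exteriorPower_map_one]
      map_mul' := fun g h => by
        rw [map_mul]
        exact exteriorPower.map_comp _ _ }
  smooth := by
    obtain ⟨U, hU⟩ := A.smooth
    refine ⟨U, fun g hg => ?_⟩
    have h : exteriorPower.map n (A.ρ g) = 1 := by rw [hU g hg, exteriorPower_map_one]
    exact h

theorem sum_congr {A A' B B' : SmoothRep K G} (hA : A ≈ A') (hB : B ≈ B') :
    A.sum B ≈ A'.sum B' := by
  obtain ⟨e, he⟩ := exists_of_equiv hA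
  obtain ⟨f, hf⟩ := exists_of_equiv hB
  exact equiv_of (A := A.sum B) (B := A'.sum B') (e.prodCongr f)
    fun g => LinearMap.ext fun x =>
      Prod.ext (LinearMap.congr_fun (he g) x.1) (LinearMap.congr_fun (hf g) x.2)

theorem tensor_congr {A A' B B' : SmoothRep K G} (hA : A ≈ A') (hB : B ≈ B') :
    A.tensor B ≈ A'.tensor B' := by
  obtain ⟨e, he⟩ := exists_of_equiv hA
  obtain ⟨f, hf⟩ := exists_of_equiv hB
  have key : ∀ g, (TensorProduct.congr e f).toLinearMap ∘ₗ TensorProduct.map (A.ρ g) (B.ρ g) =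
      TensorProduct.map (A'.ρ g) (B'.ρ g) ∘ₗ (TensorProduct.congr e f).toLinearMap := by
    intro g
    have h1 := he g
    have h2 := hf g
    rw [TensorProduct.toLinearMap_congr, ← TensorProduct.map_comp, ← TensorProduct.map_comp, h1, h2]
  exact equiv_of (A := A.tensor B) (B := A'.tensor B') (TensorProduct.congr e f) key

theorem ext_congr (n : ℕ) {A B : SmoothRep K G} (h : A ≈ B) : A.ext n ≈ B.ext n := by
  obtain ⟨e, he⟩ := exists_of_equiv h
  have h1 : (exteriorPower.map n e.toLinearMap) ∘ₗ (exteriorPower.map n e.symm.toLinearMap) =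
      LinearMap.id := by
    rw [← exteriorPower.map_comp, LinearEquiv.comp_symm, exteriorPower.map_id]
  have h2 : (exteriorPower.map n e.symm.toLinearMap) ∘ₗ (exteriorPower.map n e.toLinearMap) =
      LinearMap.id := by
    rw [← exteriorPower.map_comp, LinearEquiv.symm_comp, exteriorPower.map_id]
  have key : ∀ g, exteriorPower.map n e.toLinearMap ∘ₗ exteriorPower.map n (A.ρ g) =
      exteriorPower.map n (B.ρ g) ∘ₗ exteriorPower.map n e.toLinearMap := by
    intro g
    rw [← exteriorPower.map_comp, ← exteriorPower.map_comp, he g]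
  exact equiv_of (A := A.ext n) (B := B.ext n) (LinearEquiv.ofLinearMap _ _ h1 h2) key

end SmoothRep

/-- Isomorphism classes of smooth representations. -/
def RepClass (K : Type u) [Field K] (G : Type v) [Group G] [TopologicalSpace G] : Type (max (u + 1) v) :=
  Quotient (SmoothRep.setoid (K := K) (G := G))

namespace RepClass

open SmoothRep

variable {K : Type u} [Field K] {G : Type v} [Group G] [TopologicalSpace G]

/-- The isomorphism class of a representation. -/
def mk (A : SmoothRep K G) : RepClass K G := Quotient.mk _ A

/-- Direct sum of isomorphism classes. -/
instance : Add (RepClass K G) :=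
  ⟨Quotient.map₂ SmoothRep.sum fun _ _ h _ _ h' => sum_congr h h'⟩

/-- Tensor product of isomorphism classes. -/
instance : Mul (RepClass K G) :=
  ⟨Quotient.map₂ tensor fun _ _ h _ _ h' => tensor_congr h h'⟩

instance : Zero (RepClass K G) := ⟨mk zero⟩

instance : One (RepClass K G) := ⟨mk one⟩

/-- Isomorphism classes form a commutative semiring under direct sum and tensor product. -/
instance : CommSemiring (RepClass K G) where
  nsmul := nsmulRec
  npow := npowRec
  add_assoc := by
    rintro ⟨A⟩ ⟨B⟩ ⟨C⟩
    exact Quotient.sound (equiv_of (A := (A.sum B).sum C) (B := A.sum (B.sum C))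
      (LinearEquiv.prodAssoc K A.V B.V C.V) fun _ => rfl)
  zero_add := by
    rintro ⟨A⟩
    exact Quotient.sound (equiv_of (A := zero.sum A) (B := A)
      (LinearEquiv.uniqueProd (R := K) (M := A.V) (M₂ := PUnit.{u + 1})) fun _ => rfl)
  add_zero := by
    rintro ⟨A⟩
    exact Quotient.sound (equiv_of (A := A.sum zero) (B := A)
      (LinearEquiv.prodUnique (R := K) (M := A.V) (M₂ := PUnit.{u + 1})) fun _ => rfl)
  add_comm := by
    rintro ⟨A⟩ ⟨B⟩
    exact Quotient.sound (equiv_of (A := A.sum B) (B := B.sum A)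
      (LinearEquiv.prodComm K A.V B.V) fun _ => rfl)
  mul_assoc := by
    rintro ⟨A⟩ ⟨B⟩ ⟨C⟩
    exact Quotient.sound (equiv_of (A := (A.tensor B).tensor C) (B := A.tensor (B.tensor C))
      (TensorProduct.assoc K A.V B.V C.V) fun g =>
        (TensorProduct.map_map_comp_assoc_eq (A.ρ g) (B.ρ g) (C.ρ g)).symm)
  one_mul := by
    rintro ⟨A⟩
    have key : ∀ f : A.V →ₗ[K] A.V, (TensorProduct.lid K A.V).toLinearMap ∘ₗ
        TensorProduct.map LinearMap.id f = f ∘ₗ (TensorProduct.lid K A.V).toLinearMap := by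
      intro f
      ext
      simp
    exact Quotient.sound (equiv_of (A := one.tensor A) (B := A)
      (TensorProduct.lid K A.V) fun g => key (A.ρ g))
  mul_one := by
    rintro ⟨A⟩
    have key : ∀ f : A.V →ₗ[K] A.V, (TensorProduct.rid K A.V).toLinearMap ∘ₗ
        TensorProduct.map f LinearMap.id = f ∘ₗ (TensorProduct.rid K A.V).toLinearMap := by
      intro f
      ext
      simp
    exact Quotient.sound (equiv_of (A := A.tensor one) (B := A)
      (TensorProduct.rid K A.V) fun g => key (A.ρ g))
  mul_comm := by
    rintro ⟨A⟩ ⟨B⟩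
    have key : ∀ (f : A.V →ₗ[K] A.V) (h : B.V →ₗ[K] B.V),
        (TensorProduct.comm K A.V B.V).toLinearMap ∘ₗ TensorProduct.map f h =
          TensorProduct.map h f ∘ₗ (TensorProduct.comm K A.V B.V).toLinearMap := by
      intro f h
      exact TensorProduct.ext' fun a b => by simp
    exact Quotient.sound (equiv_of (A := A.tensor B) (B := B.tensor A)
      (TensorProduct.comm K A.V B.V) fun g => key (A.ρ g) (B.ρ g))
  zero_mul := by
    rintro ⟨A⟩
    exact Quotient.sound (equiv_of (A := zero.tensor A) (B := zero)
      (0 : PUnit.{u + 1} ⊗[K] A.V ≃ₗ[K] PUnit.{u + 1}) fun g => rfl)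
  mul_zero := by
    rintro ⟨A⟩
    exact Quotient.sound (equiv_of (A := A.tensor zero) (B := zero)
      (0 : A.V ⊗[K] PUnit.{u + 1} ≃ₗ[K] PUnit.{u + 1}) fun g => rfl)
  left_distrib := by
    rintro ⟨A⟩ ⟨B⟩ ⟨C⟩
    have key : ∀ (f : A.V →ₗ[K] A.V) (h : B.V →ₗ[K] B.V) (k : C.V →ₗ[K] C.V),
        (TensorProduct.prodRight K K A.V B.V C.V).toLinearMap ∘ₗ TensorProduct.map f (h.prodMap k) =
          ((TensorProduct.map f h).prodMap (TensorProduct.map f k)) ∘ₗ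
            (TensorProduct.prodRight K K A.V B.V C.V).toLinearMap := by
      intro f h k
      exact TensorProduct.ext' fun a b => by simp
    exact Quotient.sound (equiv_of (A := A.tensor (B.sum C)) (B := (A.tensor B).sum (A.tensor C))
      (TensorProduct.prodRight K K A.V B.V C.V) fun g => key (A.ρ g) (B.ρ g) (C.ρ g))
  right_distrib := by
    rintro ⟨A⟩ ⟨B⟩ ⟨C⟩
    have key : ∀ (f : A.V →ₗ[K] A.V) (h : B.V →ₗ[K] B.V) (k : C.V →ₗ[K] C.V),
        (TensorProduct.prodLeft K K A.V B.V C.V).toLinearMap ∘ₗ TensorProduct.map (f.prodMap h) k =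
          ((TensorProduct.map f k).prodMap (TensorProduct.map h k)) ∘ₗ
            (TensorProduct.prodLeft K K A.V B.V C.V).toLinearMap := by
      intro f h k
      exact TensorProduct.ext' fun a b => by obtain ⟨a, c⟩ := a; simp
    exact Quotient.sound (equiv_of (A := (A.sum B).tensor C) (B := (A.tensor C).sum (B.tensor C))
      (TensorProduct.prodLeft K K A.V B.V C.V) fun g => key (A.ρ g) (B.ρ g) (C.ρ g))

theorem mk_add_mk (A B : SmoothRep K G) : mk A + mk B = mk (A.sum B) := rfl

theorem mk_mul_mk (A B : SmoothRep K G) : mk A * mk B = mk (A.tensor B) := rfl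

theorem zero_def : (0 : RepClass K G) = mk zero := rfl

theorem one_def : (1 : RepClass K G) = mk one := rfl

end RepClass

namespace ExteriorSum

open ExteriorAlgebra

variable {K : Type u} [Field K] {M N : Type u} [AddCommGroup M] [Module K M]
  [AddCommGroup N] [Module K N]

theorem coe_exteriorPower_map (n : ℕ) (f : M →ₗ[K] N) (x : ⋀[K]^n M) :
    (exteriorPower.map n f x : ExteriorAlgebra K N) = ExteriorAlgebra.map f x := by
  have h : (⋀[K]^n N).subtype ∘ₗ exteriorPower.map n f =
      (ExteriorAlgebra.map f).toLinearMap ∘ₗ (⋀[K]^n M).subtype := by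
    refine exteriorPower.linearMap_ext ?_
    ext v
    simp [exteriorPower.map_apply_ιMulti]
  exact LinearMap.congr_fun h x

theorem map_mem (n : ℕ) (f : M →ₗ[K] N) {x : ExteriorAlgebra K M} (hx : x ∈ ⋀[K]^n M) :
    ExteriorAlgebra.map f x ∈ ⋀[K]^n N := by
  rw [← coe_exteriorPower_map n f ⟨x, hx⟩]
  exact Subtype.property _

/-- Products `a ∧ b` with `a` in the `i`-th exterior power of `M` and `b` in the `j`-th exterior
power of `N`, as a linear map into the exterior algebra of `M × N`. -/
def wedge (i j : ℕ) : (⋀[K]^i M) ⊗[K] (⋀[K]^j N) →ₗ[K] ExteriorAlgebra K (M × N) :=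
  TensorProduct.lift ((LinearMap.mul K (ExteriorAlgebra K (M × N))).compl₁₂
    ((ExteriorAlgebra.map (LinearMap.inl K M N)).toLinearMap ∘ₗ (⋀[K]^i M).subtype)
    ((ExteriorAlgebra.map (LinearMap.inr K M N)).toLinearMap ∘ₗ (⋀[K]^j N).subtype))

theorem wedge_tmul (i j : ℕ) (a : ⋀[K]^i M) (b : ⋀[K]^j N) :
    wedge i j (a ⊗ₜ[K] b) = ExteriorAlgebra.map (LinearMap.inl K M N) a *
      ExteriorAlgebra.map (LinearMap.inr K M N) b := rfl

theorem wedge_mem {i j n : ℕ} (h : i + j = n) (x : (⋀[K]^i M) ⊗[K] (⋀[K]^j N)) :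
    wedge i j x ∈ ⋀[K]^n (M × N) := by
  induction x with
  | zero => simp
  | tmul a b =>
    rw [wedge_tmul, ← h]
    change _ ∈ (LinearMap.range (ι K)) ^ (i + j)
    rw [pow_add]
    exact Submodule.mul_mem_mul (map_mem i _ a.2) (map_mem j _ b.2)
  | add a b ha hb =>
    rw [map_add]
    exact add_mem ha hb

/-- The sum over `i ≤ n` of the multiplication maps from `Λ^i M ⊗ Λ^(n-i) N` to `Λ^n (M × N)`. -/
def total (n : ℕ) : ((i : Fin (n + 1)) → (⋀[K]^(i : ℕ) M) ⊗[K] (⋀[K]^(n - (i : ℕ)) N)) →ₗ[K]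
    ⋀[K]^n (M × N) :=
  ∑ i : Fin (n + 1), ((wedge (i : ℕ) (n - (i : ℕ))).codRestrict (⋀[K]^n (M × N))
    (wedge_mem (by omega))) ∘ₗ LinearMap.proj i

theorem coe_total (n : ℕ)
    (x : (i : Fin (n + 1)) → (⋀[K]^(i : ℕ) M) ⊗[K] (⋀[K]^(n - (i : ℕ)) N)) :
    (total n x : ExteriorAlgebra K (M × N)) = ∑ i : Fin (n + 1), wedge _ _ (x i) := by
  simp [total, LinearMap.sum_apply]

theorem wedge_natural (i j : ℕ) (f : M →ₗ[K] M) (g : N →ₗ[K] N)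
    (x : (⋀[K]^i M) ⊗[K] (⋀[K]^j N)) :
    wedge i j (TensorProduct.map (exteriorPower.map i f) (exteriorPower.map j g) x) =
      ExteriorAlgebra.map (f.prodMap g) (wedge i j x) := by
  induction x with
  | zero => simp
  | tmul a b =>
    have h1 : ∀ y, ExteriorAlgebra.map (LinearMap.inl K M N) (ExteriorAlgebra.map f y) =
        ExteriorAlgebra.map (f.prodMap g) (ExteriorAlgebra.map (LinearMap.inl K M N) y) := by
      intro y
      rw [← AlgHom.comp_apply, ← AlgHom.comp_apply, ExteriorAlgebra.map_comp_map,
        ExteriorAlgebra.map_comp_map]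
      congr 2
      ext <;> simp
    have h2 : ∀ y, ExteriorAlgebra.map (LinearMap.inr K M N) (ExteriorAlgebra.map g y) =
        ExteriorAlgebra.map (f.prodMap g) (ExteriorAlgebra.map (LinearMap.inr K M N) y) := by
      intro y
      rw [← AlgHom.comp_apply, ← AlgHom.comp_apply, ExteriorAlgebra.map_comp_map,
        ExteriorAlgebra.map_comp_map]
      congr 2
      ext <;> simp
    rw [TensorProduct.map_tmul, wedge_tmul, wedge_tmul, coe_exteriorPower_map,
      coe_exteriorPower_map, h1, h2, map_mul]
  | add a b ha hb => simp only [map_add, ha, hb]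

theorem total_natural (n : ℕ) (f : M →ₗ[K] M) (g : N →ₗ[K] N)
    (x : (i : Fin (n + 1)) → (⋀[K]^(i : ℕ) M) ⊗[K] (⋀[K]^(n - (i : ℕ)) N)) :
    total n (fun i => TensorProduct.map (exteriorPower.map (i : ℕ) f)
      (exteriorPower.map (n - (i : ℕ)) g) (x i)) =
      exteriorPower.map n (f.prodMap g) (total n x) := by
  apply Subtype.ext
  rw [coe_total, coe_exteriorPower_map, coe_total, map_sum]
  exact Finset.sum_congr rfl fun i _ => wedge_natural _ _ f g (x i)

/-- The span of the products `a ∧ b`. -/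
def prodSpan (n : ℕ) : Submodule K (ExteriorAlgebra K (M × N)) :=
  ⨆ i : Fin (n + 1), LinearMap.range (wedge (K := K) (M := M) (N := N) (i : ℕ) (n - (i : ℕ)))

theorem mul_mem_prodSpan {i j n : ℕ} (h : i + j = n) {a : ExteriorAlgebra K M}
    (ha : a ∈ ⋀[K]^i M) {b : ExteriorAlgebra K N} (hb : b ∈ ⋀[K]^j N) :
    ExteriorAlgebra.map (LinearMap.inl K M N) a * ExteriorAlgebra.map (LinearMap.inr K M N) b ∈
      prodSpan (K := K) (M := M) (N := N) n := by
  obtain rfl : j = n - i := by omega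
  refine Submodule.mem_iSup_of_mem (⟨i, by omega⟩ : Fin (n + 1)) ?_
  exact ⟨(⟨a, ha⟩ : ⋀[K]^i M) ⊗ₜ[K] (⟨b, hb⟩ : ⋀[K]^(n - i) N), rfl⟩

theorem inr_mul_inl (i : ℕ) (b : N) {x : ExteriorAlgebra K M} (hx : x ∈ ⋀[K]^i M) :
    ι K ((0, b) : M × N) * ExteriorAlgebra.map (LinearMap.inl K M N) x =
      (-1 : K) ^ i • (ExteriorAlgebra.map (LinearMap.inl K M N) x * ι K ((0, b) : M × N)) := by
  change x ∈ (LinearMap.range (ι K)) ^ i at hx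
  induction hx using Submodule.pow_induction_on_left' with
  | algebraMap r => simp [Algebra.commutes]
  | add x y i hx hy h1 h2 => rw [map_add, mul_add, h1, h2, add_mul, smul_add]
  | mem_mul m hm i x hx ih =>
    obtain ⟨m, rfl⟩ := hm
    have h : ι K ((0, b) : M × N) * ι K ((m, 0) : M × N) =
        -(ι K ((m, 0) : M × N) * ι K ((0, b) : M × N)) :=
      eq_neg_of_add_eq_zero_left (ι_add_mul_swap _ _)
    rw [map_mul, map_apply_ι, LinearMap.inl_apply, ← mul_assoc, h, neg_mul, mul_assoc, ih,
      mul_smul_comm, ← smul_neg, mul_assoc, pow_succ, mul_smul, neg_one_smul, smul_neg]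

theorem mem_prodSpan (n : ℕ) {x : ExteriorAlgebra K (M × N)} (hx : x ∈ ⋀[K]^n (M × N)) :
    x ∈ prodSpan (K := K) (M := M) (N := N) n := by
  change x ∈ (LinearMap.range (ι K)) ^ n at hx
  induction hx using Submodule.pow_induction_on_left' with
  | algebraMap r =>
    have h := mul_mem_prodSpan (K := K) (M := M) (N := N) (i := 0) (j := 0) (n := 0) rfl
      (a := algebraMap K _ r) (b := 1) (Submodule.algebraMap_mem r)
      (by simp)
    simpa using h
  | add x y i hx hy h1 h2 => exact add_mem h1 h2
  | mem_mul m hm i x hx ih =>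
    obtain ⟨⟨a, b⟩, rfl⟩ := hm
    clear hx
    have hab : ι K ((a, b) : M × N) = ι K ((a, 0) : M × N) + ι K ((0, b) : M × N) := by
      rw [← map_add]
      simp
    unfold prodSpan at ih
    induction ih using Submodule.iSup_induction' with
    | zero => simp
    | add x y _ _ h1 h2 =>
      rw [mul_add]
      exact add_mem h1 h2
    | mem k x hx =>
      obtain ⟨t, rfl⟩ := hx
      induction t with
      | zero => simp
      | add s t h1 h2 =>
        rw [map_add, mul_add]
        exact add_mem h1 h2
      | tmul s t =>
        rw [wedge_tmul, hab, add_mul]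
        refine add_mem ?_ ?_
        · have h : ι K ((a, 0) : M × N) * (ExteriorAlgebra.map (LinearMap.inl K M N) s *
              ExteriorAlgebra.map (LinearMap.inr K M N) t) =
              ExteriorAlgebra.map (LinearMap.inl K M N) (ι K a * s) *
                ExteriorAlgebra.map (LinearMap.inr K M N) t := by
            rw [map_mul, map_apply_ι, LinearMap.inl_apply, mul_assoc]
          rw [h]
          refine mul_mem_prodSpan (i := k + 1) (j := i - k) (by omega) ?_ t.2
          change _ ∈ (LinearMap.range (ι K)) ^ ((k : ℕ) + 1)
          rw [pow_succ']
          exact Submodule.mul_mem_mul ⟨a, rfl⟩ s.2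
        · rw [← mul_assoc, inr_mul_inl _ _ s.2, smul_mul_assoc]
          refine Submodule.smul_mem _ _ ?_
          have h : ExteriorAlgebra.map (LinearMap.inl K M N) (s : ExteriorAlgebra K M) *
              ι K ((0, b) : M × N) * ExteriorAlgebra.map (LinearMap.inr K M N) t =
              ExteriorAlgebra.map (LinearMap.inl K M N) s *
                ExteriorAlgebra.map (LinearMap.inr K M N) (ι K b * t) := by
            rw [map_mul, map_apply_ι, LinearMap.inr_apply, mul_assoc]
          rw [h]
          refine mul_mem_prodSpan (i := k) (j := i - k + 1) (by omega) s.2 ?_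
          change _ ∈ (LinearMap.range (ι K)) ^ (i - (k : ℕ) + 1)
          rw [pow_succ']
          exact Submodule.mul_mem_mul ⟨b, rfl⟩ t.2

theorem total_surjective (n : ℕ) :
    Function.Surjective (total (K := K) (M := M) (N := N) n) := by
  intro y
  have h : (⋀[K]^n (M × N)) ≤
      (LinearMap.range (total (K := K) (M := M) (N := N) n)).map (⋀[K]^n (M × N)).subtype := by
    intro x hx
    refine (iSup_le fun i => ?_ : prodSpan (K := K) (M := M) (N := N) n ≤ _) (mem_prodSpan n hx)
    rintro _ ⟨t, rfl⟩
    refine ⟨total n (Pi.single i t), ⟨_, rfl⟩, ?_⟩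
    rw [Submodule.subtype_apply, coe_total, Finset.sum_eq_single i]
    · simp
    · intro j _ hj
      simp [Pi.single_eq_of_ne hj]
    · simp
  obtain ⟨z, ⟨x, rfl⟩, hz⟩ := h y.2
  exact ⟨x, Subtype.ext hz⟩

theorem total_bijective [Module.Finite K M] [Module.Finite K N] (n : ℕ) :
    Function.Bijective (total (K := K) (M := M) (N := N) n) := by
  have hd : Module.finrank K
      ((i : Fin (n + 1)) → (⋀[K]^(i : ℕ) M) ⊗[K] (⋀[K]^(n - (i : ℕ)) N)) =
      Module.finrank K (⋀[K]^n (M × N)) := by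
    rw [Module.finrank_pi_fintype, exteriorPower.finrank_eq, Module.finrank_prod,
      Nat.add_choose_eq, Finset.Nat.sum_antidiagonal_eq_sum_range_succ_mk, Finset.sum_range]
    refine Finset.sum_congr rfl fun i _ => ?_
    rw [Module.finrank_tensorProduct, exteriorPower.finrank_eq, exteriorPower.finrank_eq]
  refine ⟨?_, total_surjective n⟩
  obtain ⟨e⟩ := FiniteDimensional.nonempty_linearEquiv_of_finrank_eq hd
  have h : Function.Injective (e.symm.toLinearMap ∘ₗ total (K := K) (M := M) (N := N) n) :=
    OrzechProperty.injective_of_surjective_endomorphism _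
      (e.symm.surjective.comp (total_surjective n))
  exact Function.Injective.of_comp h

end ExteriorSum

namespace RepClass

open SmoothRep

variable {K : Type u} [Field K] {G : Type v} [Group G] [TopologicalSpace G]

/-- Direct sum of a finite family of representations. -/
def _root_.SmoothRep.pi {k : ℕ} (A : Fin k → SmoothRep K G) : SmoothRep K G where
  V := (i : Fin k) → (A i).V
  ρ :=
    { toFun := fun g => LinearMap.pi fun i => (A i).ρ g ∘ₗ LinearMap.proj i
      map_one' := by
        refine LinearMap.ext fun x => funext fun i => ?_
        simp
      map_mul' := fun g h => by
        refine LinearMap.ext fun x => funext fun i => ?_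
        simp }
  smooth := by
    choose U hU using fun i => (A i).smooth
    refine ⟨Finset.univ.inf U, fun g hg => ?_⟩
    refine LinearMap.ext fun x => funext fun i => ?_
    have hg' : g ∈ U i := (Finset.inf_le (Finset.mem_univ i) : Finset.univ.inf U ≤ U i) hg
    simp [hU i g hg']

theorem sum_mk {k : ℕ} (A : Fin k → SmoothRep K G) : ∑ i, mk (A i) = mk (SmoothRep.pi A) := by
  induction k with
  | zero =>
    rw [Fin.sum_univ_zero]
    exact Quotient.sound (equiv_of (A := zero) (B := SmoothRep.pi A)
      (0 : PUnit.{u + 1} ≃ₗ[K] ((i : Fin 0) → (A i).V)) fun g =>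
        LinearMap.ext fun x => funext fun i => i.elim0)
  | succ k ih =>
    rw [Fin.sum_univ_succ, ih, mk_add_mk]
    refine Quotient.sound (equiv_of
      (A := (A 0).sum (SmoothRep.pi fun i : Fin k => A i.succ)) (B := SmoothRep.pi A)
      (Fin.consLinearEquiv K fun i => (A i).V) fun g => ?_)
    refine LinearMap.ext fun x => funext fun i => ?_
    refine Fin.cases ?_ (fun i => ?_) i <;> rfl

/-- The `n`-th exterior power of an isomorphism class. -/
def ext (n : ℕ) : RepClass K G → RepClass K G :=
  Quotient.map (SmoothRep.ext n) fun _ _ h => ext_congr n h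

theorem ext_mk (n : ℕ) (A : SmoothRep K G) : ext n (mk A) = mk (A.ext n) := rfl

theorem ext_zero (a : RepClass K G) : ext 0 a = 1 := by
  obtain ⟨A⟩ := a
  have key : ∀ f : A.V →ₗ[K] A.V, (exteriorPower.zeroEquiv K A.V).toLinearMap ∘ₗ
      exteriorPower.map 0 f = LinearMap.id ∘ₗ (exteriorPower.zeroEquiv K A.V).toLinearMap := by
    intro f
    refine LinearMap.ext fun x => ?_
    exact LinearMap.congr_fun (exteriorPower.zeroEquiv_naturality f) x
  exact Quotient.sound (equiv_of (A := A.ext 0) (B := one) (exteriorPower.zeroEquiv K A.V)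
    fun g => key (A.ρ g))

/-- Exterior powers of a direct sum. -/
theorem ext_add (n : ℕ) (a b : RepClass K G) :
    ext n (a + b) = ∑ q ∈ Finset.HasAntidiagonal.antidiagonal n, ext q.1 a * ext q.2 b := by
  obtain ⟨A⟩ := a
  obtain ⟨B⟩ := b
  rw [Finset.Nat.sum_antidiagonal_eq_sum_range_succ_mk, Finset.sum_range]
  refine Eq.trans ?_
    (sum_mk fun i : Fin (n + 1) => (A.ext (i : ℕ)).tensor (B.ext (n - (i : ℕ)))).symm
  refine (Quotient.sound (equiv_of
    (A := SmoothRep.pi fun i : Fin (n + 1) => (A.ext (i : ℕ)).tensor (B.ext (n - (i : ℕ))))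
    (B := (A.sum B).ext n)
    (LinearEquiv.ofBijective (ExteriorSum.total n) (ExteriorSum.total_bijective n))
    fun g => LinearMap.ext fun x => ?_)).symm
  exact ExteriorSum.total_natural n (A.ρ g) (B.ρ g) x

end RepClass

/-- The representation ring: the Grothendieck ring of the semiring of isomorphism classes. -/
def RepRing (K : Type u) [Field K] (G : Type v) [Group G] [TopologicalSpace G] :
    Type (max (u + 1) v) :=
  Algebra.GrothendieckAddGroup (RepClass K G)

namespace RepRing

variable {K : Type u} [Field K] {G : Type v} [Group G] [TopologicalSpace G]

instance : AddCommGroup (RepRing K G) :=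
  inferInstanceAs (AddCommGroup (Algebra.GrothendieckAddGroup (RepClass K G)))

/-- The class in the representation ring of an isomorphism class of representations. -/
def cls : RepClass K G →+ RepRing K G := Algebra.GrothendieckAddGroup.of

/-- The class in the representation ring of a representation. -/
def ofRep (A : SmoothRep K G) : RepRing K G := cls (RepClass.mk A)

/-- Extension of an additive map from representations to virtual representations. -/
def lift {A : Type*} [AddCommGroup A] (f : RepClass K G →+ A) : RepRing K G →+ A :=
  Algebra.GrothendieckAddGroup.lift f

theorem lift_cls {A : Type*} [AddCommGroup A] (f : RepClass K G →+ A) (a : RepClass K G) :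
    lift f (cls a) = f a :=
  DFunLike.congr_fun (Algebra.GrothendieckAddGroup.lift.symm_apply_apply f) a

theorem hom_ext {A : Type*} [AddCommGroup A] {f g : RepRing K G →+ A}
    (h : ∀ a, f (cls a) = g (cls a)) : f = g :=
  Algebra.GrothendieckAddGroup.lift.symm.injective (AddMonoidHom.ext h)

/-- Multiplication, the biadditive extension of the tensor product. -/
def mulHom : RepRing K G →+ RepRing K G →+ RepRing K G :=
  lift
    { toFun := fun a => lift (cls.comp (AddMonoidHom.mulLeft a))
      map_zero' := hom_ext fun b => by simp [lift_cls]
      map_add' := fun a b => hom_ext fun c => by simp [lift_cls, add_mul] }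

theorem mulHom_cls (a b : RepClass K G) : mulHom (cls a) (cls b) = cls (a * b) := by
  simp [mulHom, lift_cls]

instance : Mul (RepRing K G) := ⟨fun x y => mulHom x y⟩

instance : One (RepRing K G) := ⟨cls 1⟩

theorem mul_def (x y : RepRing K G) : x * y = mulHom x y := rfl

theorem one_def : (1 : RepRing K G) = cls 1 := rfl

theorem cls_mul (a b : RepClass K G) : cls (a * b) = cls a * cls b := (mulHom_cls a b).symm

theorem induction {P : RepRing K G → Prop} (h1 : ∀ a, P (cls a))
    (h2 : ∀ x y, P x → P y → P (x + y)) (h3 : ∀ x, P x → P (-x)) (x : RepRing K G) : P x := by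
  have h : AddSubgroup.closure (Set.range (cls (K := K) (G := G))) = ⊤ := by
    rw [← QuotientAddGroup.ker_mk' (AddSubgroup.closure (Set.range (cls (K := K) (G := G)))),
      AddMonoidHom.ker_eq_top_iff]
    refine hom_ext fun a => ?_
    exact (QuotientAddGroup.eq_zero_iff _).2 (AddSubgroup.subset_closure ⟨a, rfl⟩)
  have hx : x ∈ AddSubgroup.closure (Set.range (cls (K := K) (G := G))) := h ▸ AddSubgroup.mem_top x
  induction hx using AddSubgroup.closure_induction with
  | mem y hy =>
    obtain ⟨a, rfl⟩ := hy
    exact h1 a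
  | zero => simpa using h1 0
  | add y z _ _ hy hz => exact h2 y z hy hz
  | neg y _ hy => exact h3 y hy

instance : CommRing (RepRing K G) where
  __ := (inferInstance : AddCommGroup (RepRing K G))
  left_distrib x y z := (mulHom x).map_add y z
  right_distrib x y z := by simp only [mul_def, map_add, AddMonoidHom.add_apply]
  zero_mul x := by simp only [mul_def, map_zero, AddMonoidHom.zero_apply]
  mul_zero x := (mulHom x).map_zero
  mul_assoc x y z := by
    simp only [mul_def]
    induction x using RepRing.induction with
    | h1 a =>
      induction y using RepRing.induction with
      | h1 b =>
        induction z using RepRing.induction with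
        | h1 c => simp only [mulHom_cls, mul_assoc]
        | h2 x y hx hy => simp only [map_add, hx, hy]
        | h3 x hx => simp only [map_neg, hx]
      | h2 x y hx hy => simp only [map_add, AddMonoidHom.add_apply, hx, hy]
      | h3 x hx => simp only [map_neg, AddMonoidHom.neg_apply, hx]
    | h2 x y hx hy => simp only [map_add, AddMonoidHom.add_apply, hx, hy]
    | h3 x hx => simp only [map_neg, AddMonoidHom.neg_apply, hx]
  one_mul x := by
    simp only [mul_def, one_def]
    induction x using RepRing.induction with
    | h1 a => simp only [mulHom_cls, one_mul]
    | h2 x y hx hy => simp only [map_add, hx, hy]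
    | h3 x hx => simp only [map_neg, hx]
  mul_one x := by
    simp only [mul_def, one_def]
    induction x using RepRing.induction with
    | h1 a => simp only [mulHom_cls, mul_one]
    | h2 x y hx hy => simp only [map_add, AddMonoidHom.add_apply, hx, hy]
    | h3 x hx => simp only [map_neg, AddMonoidHom.neg_apply, hx]
  mul_comm x y := by
    simp only [mul_def]
    induction x using RepRing.induction with
    | h1 a =>
      induction y using RepRing.induction with
      | h1 b => simp only [mulHom_cls, mul_comm]
      | h2 x y hx hy => simp only [map_add, AddMonoidHom.add_apply, hx, hy]
      | h3 x hx => simp only [map_neg, AddMonoidHom.neg_apply, hx]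
    | h2 x y hx hy => simp only [map_add, AddMonoidHom.add_apply, hx, hy]
    | h3 x hx => simp only [map_neg, AddMonoidHom.neg_apply, hx]

/-- The dimension of an isomorphism class. -/
def dimHom : RepClass K G →+ ℤ where
  toFun := Quotient.lift (fun A : SmoothRep K G => (Module.finrank K A.V : ℤ)) fun A B h => by
    obtain ⟨e, -⟩ := SmoothRep.exists_of_equiv h
    exact congrArg Nat.cast e.finrank_eq
  map_zero' := by
    change (Module.finrank K PUnit.{u + 1} : ℤ) = 0
    rw [Module.finrank_zero_of_subsingleton, Nat.cast_zero]
  map_add' := by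
    rintro ⟨A⟩ ⟨B⟩
    change (Module.finrank K (A.V × B.V) : ℤ) = _
    rw [Module.finrank_prod, Nat.cast_add]

/-- The augmentation, sending the class of a representation to its dimension. -/
def augmentation : RepRing K G →+* ℤ :=
  { lift dimHom with
    map_one' := by
      change lift dimHom (cls 1) = 1
      rw [lift_cls]
      change (Module.finrank K K : ℤ) = 1
      simp
    map_mul' := fun x y => by
      change lift dimHom (x * y) = lift dimHom x * lift dimHom y
      induction x using RepRing.induction with
      | h1 a =>
        induction y using RepRing.induction with
        | h1 b =>
          rw [← cls_mul, lift_cls, lift_cls, lift_cls]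
          obtain ⟨A⟩ := a
          obtain ⟨B⟩ := b
          change (Module.finrank K (A.V ⊗[K] B.V) : ℤ) = _
          rw [Module.finrank_tensorProduct, Nat.cast_mul]
          rfl
        | h2 x y hx hy => simp only [mul_add, map_add, hx, hy]
        | h3 x hx => simp only [mul_neg, map_neg, hx]
      | h2 x y hx hy => simp only [add_mul, map_add, hx, hy]
      | h3 x hx => simp only [neg_mul, map_neg, hx] }

/-- The augmentation ideal. -/
def augIdeal (K : Type u) [Field K] (G : Type v) [Group G] [TopologicalSpace G] :
    Ideal (RepRing K G) :=
  RingHom.ker augmentation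

open PowerSeries

/-- The power series `∑ [Λ^n V] t^n` of a representation `V`, as a unit. -/
def lambdaUnit (a : RepClass K G) : (RepRing K G)⟦X⟧ˣ :=
  IsUnit.unit (a := PowerSeries.mk fun n => cls (RepClass.ext n a)) <| by
    rw [PowerSeries.isUnit_iff_constantCoeff, ← PowerSeries.coeff_zero_eq_constantCoeff_apply,
      PowerSeries.coeff_mk, RepClass.ext_zero]
    exact isUnit_one

theorem coe_lambdaUnit (a : RepClass K G) :
    (lambdaUnit a : (RepRing K G)⟦X⟧) = PowerSeries.mk fun n => cls (RepClass.ext n a) := rfl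

theorem lambdaUnit_add (a b : RepClass K G) :
    lambdaUnit (a + b) = lambdaUnit a * lambdaUnit b := by
  apply Units.ext
  rw [Units.val_mul, coe_lambdaUnit, coe_lambdaUnit, coe_lambdaUnit]
  ext n
  rw [PowerSeries.coeff_mul, PowerSeries.coeff_mk, RepClass.ext_add, map_sum]
  refine Finset.sum_congr rfl fun q _ => ?_
  rw [PowerSeries.coeff_mk, PowerSeries.coeff_mk, cls_mul]

/-- The total lambda operation `λ_t`, turning sums into products. -/
def lambdaHom : RepRing K G →+ Additive (RepRing K G)⟦X⟧ˣ :=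
  lift
    { toFun := fun a => Additive.ofMul (lambdaUnit a)
      map_zero' := by
        have h := lambdaUnit_add (0 : RepClass K G) 0
        rw [add_zero] at h
        exact congrArg Additive.ofMul (left_eq_mul.mp h)
      map_add' := lambdaUnit_add }

/-- The total lambda operation of `x`, that is `λ_t(x) = ∑ λ^n(x) t^n`. -/
def lambdaSeries (x : RepRing K G) : (RepRing K G)⟦X⟧ˣ := (lambdaHom x).toMul

/-- The total gamma operation `γ_t(x) = λ_{t/(1-t)}(x)`. -/
def gammaSeries (x : RepRing K G) : (RepRing K G)⟦X⟧ :=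
  (lambdaSeries x : (RepRing K G)⟦X⟧).subst (X * PowerSeries.mk (fun _ => 1) : (RepRing K G)⟦X⟧)

/-- The gamma operation `γ^n`. -/
def gammaOp (n : ℕ) (x : RepRing K G) : RepRing K G := coeff n (gammaSeries x)

/-- The `n`-th step of the gamma filtration: the subgroup generated by all monomials
`γ^{n₁}(x₁) ⋯ γ^{nₖ}(xₖ)` with all `xⱼ` in the augmentation ideal and `n₁ + ⋯ + nₖ ≥ n`. -/
def gammaFil (K : Type u) [Field K] (G : Type v) [Group G] [TopologicalSpace G] (n : ℕ) :
    AddSubgroup (RepRing K G) :=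
  AddSubgroup.closure {y | ∃ l : List (ℕ × RepRing K G), (∀ q ∈ l, q.2 ∈ augIdeal K G) ∧
    n ≤ (l.map Prod.fst).sum ∧ y = (l.map fun q => gammaOp q.1 q.2).prod}

/-- The logarithmic derivative `-t · (d/dt λ_{-t}(x)) / λ_{-t}(x)`, the generating series
of the Adams operators. -/
def adamsSeries (x : RepRing K G) : (RepRing K G)⟦X⟧ :=
  -(X * derivative (RepRing K G) (rescale (-1) (lambdaSeries x : (RepRing K G)⟦X⟧)) *
    rescale (-1) ((lambdaSeries x)⁻¹ : (RepRing K G)⟦X⟧ˣ).val)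

theorem adamsSeries_add (x y : RepRing K G) :
    adamsSeries (x + y) = adamsSeries x + adamsSeries y := by
  have h : ∀ z : RepRing K G, rescale (-1) (lambdaSeries z : (RepRing K G)⟦X⟧) *
      rescale (-1) ((lambdaSeries z)⁻¹ : (RepRing K G)⟦X⟧ˣ).val = 1 := by
    intro z
    rw [← map_mul, Units.mul_inv, map_one]
  have hxy : lambdaSeries (x + y) = lambdaSeries x * lambdaSeries y := by
    simp only [lambdaSeries, map_add, toMul_add]
  simp only [adamsSeries, hxy, mul_inv, Units.val_mul, map_mul, Derivation.leibniz, smul_eq_mul]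
  linear_combination
    (-(X * rescale (-1) ((lambdaSeries y)⁻¹ : (RepRing K G)⟦X⟧ˣ).val *
      derivative (RepRing K G) (rescale (-1) (lambdaSeries y : (RepRing K G)⟦X⟧)))) * h x +
    (-(X * rescale (-1) ((lambdaSeries x)⁻¹ : (RepRing K G)⟦X⟧ˣ).val *
      derivative (RepRing K G) (rescale (-1) (lambdaSeries x : (RepRing K G)⟦X⟧)))) * h y

/-- The Adams operator `ψ^k`. -/
def adams (k : ℕ) : RepRing K G →+ RepRing K G :=
  AddMonoidHom.mk' (fun x => coeff k (adamsSeries x)) fun x y => by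
    rw [adamsSeries_add, map_add]

/-- The trace of `g` on virtual representations. -/
def traceHom (g : G) : RepRing K G →+ K :=
  lift
    { toFun := Quotient.lift (fun A : SmoothRep K G => LinearMap.trace K A.V (A.ρ g))
        fun A B h => by
          obtain ⟨e, he⟩ := SmoothRep.exists_of_equiv h
          have h1 : B.ρ g = e.conj (A.ρ g) := by
            rw [LinearEquiv.conj_apply, he g, LinearMap.comp_assoc, LinearEquiv.comp_symm,
              LinearMap.comp_id]
          change LinearMap.trace K A.V (A.ρ g) = LinearMap.trace K B.V (B.ρ g)
          rw [h1, LinearMap.trace_conj']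
      map_zero' := by
        have h : ∀ f : PUnit.{u + 1} →ₗ[K] PUnit.{u + 1}, LinearMap.trace K _ f = 0 := by
          intro f
          rw [Subsingleton.elim f 0, map_zero]
        exact h _
      map_add' := by
        rintro ⟨A⟩ ⟨B⟩
        exact LinearMap.trace_prodMap' (A.ρ g) (B.ρ g) }

/-- The determinant of `g` on a representation, as a unit. -/
def detUnit (g : G) (A : SmoothRep K G) : Kˣ := Units.map LinearMap.det (A.ρ.asGroupHom g)

theorem coe_detUnit (g : G) (A : SmoothRep K G) :
    (detUnit g A : K) = LinearMap.det (A.ρ g) := rfl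

/-- The homomorphism `DET(g)` on virtual representations, sending the class of `V` to the
determinant of `g` acting on `V`. -/
def det (g : G) : RepRing K G →+ Additive Kˣ :=
  lift
    { toFun := Quotient.lift (fun A : SmoothRep K G => Additive.ofMul (detUnit g A))
        fun A B h => by
          obtain ⟨e, he⟩ := SmoothRep.exists_of_equiv h
          have h1 : B.ρ g = e.toLinearMap ∘ₗ A.ρ g ∘ₗ e.symm.toLinearMap := by
            rw [← LinearMap.comp_assoc, he g, LinearMap.comp_assoc, LinearEquiv.comp_symm,
              LinearMap.comp_id]
          refine congrArg Additive.ofMul (Units.ext ?_)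
          rw [coe_detUnit, coe_detUnit, h1, LinearMap.det_conj]
      map_zero' := by
        refine congrArg Additive.ofMul (Units.ext ?_ : detUnit g SmoothRep.zero = (1 : Kˣ))
        exact LinearMap.det_eq_one_of_subsingleton (M := PUnit.{u + 1}) _
      map_add' := by
        rintro ⟨A⟩ ⟨B⟩
        refine congrArg Additive.ofMul
          (Units.ext ?_ : detUnit g (A.sum B) = detUnit g A * detUnit g B)
        exact LinearMap.det_prodMap (A.ρ g) (B.ρ g) }

end RepRing

/-- The space `M` with scalar multiplication twisted by a field automorphism `σ`, so that
`σ c` now acts as `c` did before. It is the base change of `M` along `σ`. -/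
def Conj {K : Type u} [Field K] (_ : K ≃+* K) (M : Type u) : Type u := M

namespace Conj

variable {K : Type u} [Field K] (σ : K ≃+* K) {M N : Type u} [AddCommGroup M] [Module K M]
  [AddCommGroup N] [Module K N]

instance : AddCommGroup (Conj σ M) := inferInstanceAs (AddCommGroup M)

instance : Module K (Conj σ M) := Module.compHom M (σ.symm : K →+* K)

theorem smul_def (c : K) (x : M) : (c • (show Conj σ M from x)) = (σ.symm c • x : M) := rfl

/-- A linear map, viewed as a linear map between the twisted spaces. -/
def map (f : M →ₗ[K] N) : Conj σ M →ₗ[K] Conj σ N where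
  toFun := f
  map_add' := f.map_add
  map_smul' c x := f.map_smul (σ.symm c) x

/-- A linear isomorphism, viewed as a linear isomorphism between the twisted spaces. -/
def mapEquiv (e : M ≃ₗ[K] N) : Conj σ M ≃ₗ[K] Conj σ N :=
  { map σ e.toLinearMap, e.toEquiv with }

theorem finrank_eq : Module.finrank K (Conj σ M) = Module.finrank K M := by
  refine congrArg Cardinal.toNat ?_
  exact rank_eq_of_equiv_equiv (R := K) (R' := K) (M := Conj σ M) (M₁ := M) σ.symm
    (AddEquiv.refl M) σ.symm.bijective fun _ _ => rfl

instance [Module.Finite K M] : Module.Finite K (Conj σ M) := by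
  classical
  let b := Module.finBasis K M
  refine ⟨⟨Finset.univ.image (fun i => (show Conj σ M from b i)), ?_⟩⟩
  rw [eq_top_iff]
  intro x _
  have hx : (show M from x) = ∑ i, b.repr x i • b i := (b.sum_repr x).symm
  have hx' : x = ∑ i, (σ (b.repr x i)) • (show Conj σ M from b i) := by
    refine hx.trans (Finset.sum_congr rfl fun i _ => ?_)
    rw [smul_def, RingEquiv.symm_apply_apply]
  rw [hx']
  exact Submodule.sum_mem _ fun i _ => Submodule.smul_mem _ _ (Submodule.subset_span
    (Finset.mem_coe.2 (Finset.mem_image_of_mem _ (Finset.mem_univ i))))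

/-- The twist of the zero space. -/
def zeroEquiv : Conj σ PUnit.{u + 1} ≃ₗ[K] PUnit.{u + 1} where
  toFun x := x
  invFun x := x
  map_add' _ _ := rfl
  map_smul' _ _ := rfl
  left_inv _ := rfl
  right_inv _ := rfl

/-- The twist of a direct sum. -/
def prodEquiv : Conj σ (M × N) ≃ₗ[K] Conj σ M × Conj σ N where
  toFun x := x
  invFun x := x
  map_add' _ _ := rfl
  map_smul' _ _ := rfl
  left_inv _ := rfl
  right_inv _ := rfl

end Conj

/-- The conjugate of a representation by a field automorphism: its matrices in suitable bases
are obtained by applying `σ` to the entries. -/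
def SmoothRep.conj {K : Type u} [Field K] {G : Type v} [Group G] [TopologicalSpace G]
    (σ : K ≃+* K) (A : SmoothRep K G) : SmoothRep K G where
  V := Conj σ A.V
  ρ :=
    { toFun := fun g => Conj.map σ (A.ρ g)
      map_one' := LinearMap.ext fun x => by
        change A.ρ 1 x = x
        rw [map_one]
        rfl
      map_mul' := fun g h => LinearMap.ext fun x => by
        change A.ρ (g * h) x = A.ρ g (A.ρ h x)
        rw [map_mul]
        rfl }
  smooth := by
    obtain ⟨U, hU⟩ := A.smooth
    refine ⟨U, fun g hg => LinearMap.ext fun x => ?_⟩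
    change A.ρ g x = x
    rw [hU g hg]
    rfl

namespace RepRing

variable {K : Type u} [Field K] {G : Type v} [Group G] [TopologicalSpace G]

/-- The action of field automorphisms of `K` on the representation ring. -/
def conj (σ : K ≃+* K) : RepRing K G →+ RepRing K G :=
  lift (cls.comp
    { toFun := Quotient.map (SmoothRep.conj σ) fun A B h => by
        obtain ⟨e, he⟩ := SmoothRep.exists_of_equiv h
        have key : ∀ g, (Conj.mapEquiv σ e).toLinearMap ∘ₗ Conj.map σ (A.ρ g) =
            Conj.map σ (B.ρ g) ∘ₗ (Conj.mapEquiv σ e).toLinearMap := fun g =>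
          LinearMap.ext fun x => LinearMap.congr_fun (he g) x
        exact SmoothRep.equiv_of (A := A.conj σ) (B := B.conj σ)
          (Conj.mapEquiv (M := A.V) (N := B.V) σ e) key
      map_zero' := by
        have key : (SmoothRep.zero (K := K) (G := G)).conj σ ≈ SmoothRep.zero :=
          SmoothRep.equiv_of (A := (SmoothRep.zero (K := K) (G := G)).conj σ)
            (B := SmoothRep.zero) (Conj.zeroEquiv σ) fun _ => rfl
        exact Quotient.sound key
      map_add' := by
        rintro ⟨A⟩ ⟨B⟩
        have key : (A.sum B).conj σ ≈ (A.conj σ).sum (B.conj σ) :=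
          SmoothRep.equiv_of (A := (A.sum B).conj σ) (B := (A.conj σ).sum (B.conj σ))
            (Conj.prodEquiv (M := A.V) (N := B.V) σ) fun _ => rfl
        exact Quotient.sound key })

theorem augmentation_conj (σ : K ≃+* K) (x : RepRing K G) :
    augmentation (conj σ x) = augmentation x := by
  have h : (augmentation (K := K) (G := G)).toAddMonoidHom.comp (conj σ) =
      (augmentation (K := K) (G := G)).toAddMonoidHom := by
    refine hom_ext fun a => ?_
    change lift dimHom (lift _ (cls a)) = lift dimHom (cls a)
    rw [lift_cls, lift_cls]
    change lift dimHom (cls _) = _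
    rw [lift_cls]
    obtain ⟨A⟩ := a
    exact congrArg Nat.cast (Conj.finrank_eq (M := A.V) σ)
  exact DFunLike.congr_fun h x

/-- The action of field automorphisms on the augmentation ideal. -/
def conjAug (σ : K ≃+* K) (x : augIdeal K G) : augIdeal K G :=
  ⟨conj σ x, by
    have h : augmentation (x : RepRing K G) = 0 := x.2
    change augmentation (conj σ (x : RepRing K G)) = 0
    rw [augmentation_conj, h]⟩

end RepRing

section Padic

variable (p : ℕ) [Fact p.Prime]

/-- The algebraic closure of the field of `p`-adic numbers. -/
abbrev QpBar : Type := AlgebraicClosure ℚ_[p]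

/-- The group of all roots of unity of `p`-power order in the algebraic closure. -/
def muPInf : Subgroup (QpBar p)ˣ where
  carrier := {z | ∃ n : ℕ, z ^ p ^ n = 1}
  one_mem' := ⟨0, by simp⟩
  mul_mem' := by
    rintro a b ⟨m, hm⟩ ⟨n, hn⟩
    refine ⟨m + n, ?_⟩
    rw [mul_pow, pow_add, pow_mul, hm, one_pow, mul_comm (p ^ m), pow_mul, hn, one_pow, one_mul]
  inv_mem' := by
    rintro a ⟨m, hm⟩
    exact ⟨m, by rw [inv_pow, hm, inv_one]⟩

/-- For a map `q : S → A` and an action of the absolute Galois group on `S`, the group of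
homomorphisms from `A` to the `p`-power roots of unity which become Galois equivariant after
composition with `q`. If `q` is surjective and the action descends to `A`, these are the
Galois equivariant homomorphisms on `A`. -/
def equivariantHoms {S A : Type*} [AddGroup A]
    (act : (QpBar p ≃ₐ[ℚ_[p]] QpBar p) → S → S) (q : S → A) :
    AddSubgroup (A →+ Additive (muPInf p)) where
  carrier := {f | ∀ (σ : QpBar p ≃ₐ[ℚ_[p]] QpBar p) (s : S),
    (((f (q (act σ s))).toMul : (QpBar p)ˣ) : QpBar p) =
      σ (((f (q s)).toMul : (QpBar p)ˣ) : QpBar p)}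
  zero_mem' σ s := by simp
  add_mem' hf hg σ s := by simp [hf σ s, hg σ s]
  neg_mem' hf σ s := by simp [hf σ s]

variable (G : Type v) [Group G] [TopologicalSpace G]

/-- The subgroup `ℤ · 1 ⊕ R_{G,2}` of the representation ring. -/
def scalarsAddGamma : AddSubgroup (RepRing (QpBar p) G) :=
  AddSubgroup.zmultiples 1 ⊔ RepRing.gammaFil (QpBar p) G 2

/-- Galois equivariant homomorphisms from `R_G / (ℤ · 1 ⊕ R_{G,2})` to `μ_{p^∞}`. -/
def galoisHomRep :
    AddSubgroup ((RepRing (QpBar p) G ⧸ scalarsAddGamma p G) →+ Additive (muPInf p)) :=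
  equivariantHoms p (fun σ => RepRing.conj σ.toRingEquiv) QuotientAddGroup.mk

/-- Galois equivariant homomorphisms from `I_G / R_{G,2}` to `μ_{p^∞}`. -/
def galoisHomAug :
    AddSubgroup ((RepRing.augIdeal (QpBar p) G ⧸ (RepRing.gammaFil (QpBar p) G 2).addSubgroupOf
      (RepRing.augIdeal (QpBar p) G).toAddSubgroup) →+ Additive (muPInf p)) :=
  equivariantHoms p (fun σ => RepRing.conjAug σ.toRingEquiv) QuotientAddGroup.mk

/-- A pro-`p` group: a profinite group all of whose open normal subgroups have `p`-power index. -/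
structure IsProPGroup : Prop where
  compactSpace : CompactSpace G
  t2Space : T2Space G
  totallyDisconnectedSpace : TotallyDisconnectedSpace G
  isTopologicalGroup : IsTopologicalGroup G
  index_eq : ∀ U : Subgroup G, U.Normal → IsOpen (U : Set G) → ∃ n : ℕ, U.index = p ^ n

end Padic

end

/-!
The theorem rests on the fact that `R_{G,2}` consists of the virtual representations of dimension
zero and trivial determinant. Hence `R_G / (ℤ · 1 ⊕ R_{G,2})` and `I_G / R_{G,2}` are the group of
characters of `G` which are trivial on an open subgroup, with `DET(g)` as evaluation at `g`, and the
isomorphisms are Pontryagin duality for `G` modulo its commutator subgroup.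

*Elements of `R_{G,2}` have trivial determinant* (`RepRing.gammaFil_two_le`). For fixed `g`,
everything can be checked after restriction along `ℤ → G`, `1 ↦ g`. Since some power of `g` acts
trivially, representations of `G` become sums of one-dimensional ones
(`RepRing.res_zpowersHom_mem_closure`), on which `λ_t(L) = 1 + L t`, `γ_t(L - 1) = 1 + (L - 1) t` and
`ψ^k(L) = L^k`. The elements of dimension zero on which `g` has determinant one form an ideal
containing all products of two elements of the augmentation ideal, so that `γ_t(x) = 1 + x t` modulo
this ideal. The same restriction gives characters and determinants of `ψ^k(x)`.

*The determinant is a complete invariant* (`RepRing.exists_lineClass_sub_mem`). For `V` of dimension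
`n`, the series `γ_t(V - n) = ∑ λ^i(V) t^i (1 - t)^(n - i)` is a polynomial, and its value at `t = 1`
is `λ^n(V) = ∑ γ^k(V - n)`. Modulo `R_{G,2}` this reads `λ^n(V) - 1 = V - n`, and `λ^n(V)` is
one-dimensional. Part (ii) follows by comparing dimensions and determinants.

*Duality.* A homomorphism on the group of characters is an evaluation by duality for finite abelian
groups and compactness of `G` (`IsProPGroup.exists_eval`); Galois equivariance of evaluations is
immediate, and all homomorphisms turn out to be evaluations. Injectivity requires the abstract
commutator subgroup of `G` to be closed (`IsProPGroup.isClosed_commutator`). This is where the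
analytic structure enters: the map `x ↦ x ^ p` has the invertible derivative `p` at the identity, so
by the inverse function theorem the `p`-th powers fill a neighbourhood of the identity
(`range_pow_mem_nhds_one`), and the subgroup they generate is open. Finitely many coset
representatives `x i` then generate every finite quotient, because maximal subgroups of finite
`p`-groups are normal of index `p`. In a nilpotent group generated by the `x i`, every element of the
commutator subgroup is a product of commutators `⁅y i, x i⁆`, one for each `i`
(`exists_commutatorProd_eq`), so that the commutator subgroup of `G` is the continuous image of a
compact space.
-/

noncomputable section

universe u v w

/-! ### Powers in analytic groups -/

section LiePowers

open Filter Topology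

variable {𝕜 : Type*} [NontriviallyNormedField 𝕜] {E : Type*} [NormedAddCommGroup E]
  [NormedSpace 𝕜 E] {H : Type*} [TopologicalSpace H] (I : ModelWithCorners 𝕜 E H)
  (G : Type*) [Group G] [TopologicalSpace G] [ChartedSpace H G]

/-- The multiplication of a Lie group, read in the preferred chart at the identity. -/
def chartMul (z : E × E) : E :=
  extChartAt I (1 : G) ((extChartAt I (1 : G)).symm z.1 * (extChartAt I (1 : G)).symm z.2)

theorem analyticAt_chartMul [I.Boundaryless] [LieGroup I ω G] :
    AnalyticAt 𝕜 (chartMul I G) (extChartAt I (1 : G) 1, extChartAt I (1 : G) 1) := by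
  have : IsManifold I ω G := ContMDiffMul.toIsManifold
  have hs : ContMDiffAt 𝓘(𝕜, E) I ω (extChartAt I (1 : G)).symm (extChartAt I (1 : G) 1) :=
    (contMDiffOn_extChartAt_symm 1).contMDiffAt (extChartAt_target_mem_nhds 1)
  have h1 : ContMDiffAt 𝓘(𝕜, E × E) I ω (fun z : E × E => (extChartAt I (1 : G)).symm z.1)
      (extChartAt I (1 : G) 1, extChartAt I (1 : G) 1) :=
    ContMDiffAt.comp (f := (Prod.fst : E × E → E))
      (extChartAt I (1 : G) 1, extChartAt I (1 : G) 1) hs contDiff_fst.contMDiff.contMDiffAt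
  have h2 : ContMDiffAt 𝓘(𝕜, E × E) I ω (fun z : E × E => (extChartAt I (1 : G)).symm z.2)
      (extChartAt I (1 : G) 1, extChartAt I (1 : G) 1) :=
    ContMDiffAt.comp (f := (Prod.snd : E × E → E))
      (extChartAt I (1 : G) 1, extChartAt I (1 : G) 1) hs contDiff_snd.contMDiff.contMDiffAt
  have h3 := h1.mul h2
  have h4 : ContMDiffAt I 𝓘(𝕜, E) ω (extChartAt I (1 : G))
      ((extChartAt I (1 : G)).symm (extChartAt I (1 : G) 1) *
        (extChartAt I (1 : G)).symm (extChartAt I (1 : G) 1)) := by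
    rw [extChartAt_to_inv, one_mul]
    exact contMDiffAt_extChartAt
  have h5 := ContMDiffAt.comp (extChartAt I (1 : G) 1, extChartAt I (1 : G) 1) h4 h3
  exact h5.contDiffAt.analyticAt

/-- The derivative of the multiplication at the identity is the addition of tangent vectors. -/
theorem hasStrictFDerivAt_chartMul [I.Boundaryless] [LieGroup I ω G] :
    HasStrictFDerivAt (chartMul I G)
      (ContinuousLinearMap.fst 𝕜 E E + ContinuousLinearMap.snd 𝕜 E E)
      (extChartAt I (1 : G) 1, extChartAt I (1 : G) 1) := by
  set a := extChartAt I (1 : G) 1 with ha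
  have h : HasStrictFDerivAt (chartMul I G) (fderiv 𝕜 (chartMul I G) (a, a)) (a, a) :=
    (analyticAt_chartMul I G).hasStrictFDerivAt
  have ht := extChartAt_target_mem_nhds (I := I) (1 : G)
  have hl : HasFDerivAt (fun x => chartMul I G (x, a)) (ContinuousLinearMap.id 𝕜 E) a := by
    refine (hasFDerivAt_id a).congr_of_eventuallyEq ?_
    filter_upwards [ht] with x hx
    simp only [chartMul, ha, extChartAt_to_inv, mul_one, (extChartAt I (1 : G)).right_inv hx, id]
  have hr : HasFDerivAt (fun x => chartMul I G (a, x)) (ContinuousLinearMap.id 𝕜 E) a := by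
    refine (hasFDerivAt_id a).congr_of_eventuallyEq ?_
    filter_upwards [ht] with x hx
    simp only [chartMul, ha, extChartAt_to_inv, one_mul, (extChartAt I (1 : G)).right_inv hx, id]
  have hl' := hl.unique (HasFDerivAt.comp (f := fun x => (x, a)) a h.hasFDerivAt
    ((hasFDerivAt_id a).prodMk (hasFDerivAt_const a a)))
  have hr' := hr.unique (HasFDerivAt.comp (f := fun x => (a, x)) a h.hasFDerivAt
    ((hasFDerivAt_const a a).prodMk (hasFDerivAt_id a)))
  have hL : fderiv 𝕜 (chartMul I G) (a, a) =
      ContinuousLinearMap.fst 𝕜 E E + ContinuousLinearMap.snd 𝕜 E E := by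
    refine ContinuousLinearMap.ext fun z => ?_
    have e1 := DFunLike.congr_fun hl' z.1
    have e2 := DFunLike.congr_fun hr' z.2
    simp only [ContinuousLinearMap.coe_id', id, ContinuousLinearMap.coe_comp, Function.comp,
      ContinuousLinearMap.prod_apply, zero_apply] at e1 e2
    have e3 : z = (z.1, 0) + (0, z.2) := by simp
    rw [e3, map_add, ← e1, ← e2]
    simp
  rwa [hL] at h

/-- The map `x ↦ x ^ n` of a Lie group, read in the preferred chart at the identity. -/
def chartPow (n : ℕ) (x : E) : E := extChartAt I (1 : G) ((extChartAt I (1 : G)).symm x ^ n)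

theorem chartPow_base (n : ℕ) :
    chartPow I G n (extChartAt I (1 : G) 1) = extChartAt I (1 : G) 1 := by
  simp [chartPow]

theorem eventually_pow_mem_source [LieGroup I ω G] (n : ℕ) : ∀ᶠ x in 𝓝 (extChartAt I (1 : G) 1),
    (extChartAt I (1 : G)).symm x ^ n ∈ (extChartAt I (1 : G)).source := by
  have : IsTopologicalGroup G := topologicalGroup_of_lieGroup I ω
  have h : ContinuousAt (fun x => (extChartAt I (1 : G)).symm x ^ n) (extChartAt I (1 : G) 1) :=
    (continuousAt_extChartAt_symm (I := I) (1 : G)).pow n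
  refine h.eventually_mem ?_
  rw [extChartAt_to_inv, one_pow]
  exact extChartAt_source_mem_nhds 1

/-- The derivative of `x ↦ x ^ n` at the identity is multiplication by `n`. -/
theorem hasStrictFDerivAt_chartPow [I.Boundaryless] [LieGroup I ω G] (n : ℕ) :
    HasStrictFDerivAt (chartPow I G n) ((n : 𝕜) • ContinuousLinearMap.id 𝕜 E)
      (extChartAt I (1 : G) 1) := by
  induction n with
  | zero =>
    have : chartPow I G 0 = fun _ => extChartAt I (1 : G) 1 := by
      funext x
      simp [chartPow]
    rw [this, Nat.cast_zero, zero_smul]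
    exact hasStrictFDerivAt_const _ _
  | succ n ih =>
    have h1 := hasStrictFDerivAt_chartMul I G
    have h2 := ih.prodMk (hasStrictFDerivAt_id (𝕜 := 𝕜) (extChartAt I (1 : G) 1))
    have h1' : HasStrictFDerivAt (chartMul I G)
        (ContinuousLinearMap.fst 𝕜 E E + ContinuousLinearMap.snd 𝕜 E E)
        (chartPow I G n (extChartAt I (1 : G) 1), id (extChartAt I (1 : G) 1)) := by
      rw [chartPow_base]
      exact h1
    have h3 := HasStrictFDerivAt.comp (f := fun x => (chartPow I G n x, x)) _ h1' h2
    have h4 : (ContinuousLinearMap.fst 𝕜 E E + ContinuousLinearMap.snd 𝕜 E E) ∘SL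
        (((n : 𝕜) • ContinuousLinearMap.id 𝕜 E).prod (ContinuousLinearMap.id 𝕜 E)) =
        ((n + 1 : ℕ) : 𝕜) • ContinuousLinearMap.id 𝕜 E := by
      refine ContinuousLinearMap.ext fun z => ?_
      simp [add_smul]
    rw [h4] at h3
    refine h3.congr_of_eventuallyEq ?_
    filter_upwards [eventually_pow_mem_source I G n] with x hx
    simp only [chartMul, chartPow, (extChartAt I (1 : G)).left_inv hx, pow_succ]

/-- In characteristic zero the inverse function theorem applies to `x ↦ x ^ n` at the identity,
so that the `n`-th powers fill a neighbourhood of the identity. -/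
theorem range_pow_mem_nhds_one [I.Boundaryless] [LieGroup I ω G] [CompleteSpace E] [CharZero 𝕜]
    {n : ℕ} (hn : n ≠ 0) :
    Set.range (fun x : G => x ^ n) ∈ 𝓝 (1 : G) := by
  have hn' : (n : 𝕜) ≠ 0 := Nat.cast_ne_zero.mpr hn
  have h : HasStrictFDerivAt (chartPow I G n)
      ((ContinuousLinearEquiv.smulLeft (R₁ := 𝕜) (M₁ := E) (Units.mk0 (n : 𝕜) hn') : E ≃L[𝕜] E) :
        E →L[𝕜] E) (extChartAt I (1 : G) 1) :=
    hasStrictFDerivAt_chartPow I G n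
  have hmap := h.map_nhds_eq_of_equiv
  rw [chartPow_base] at hmap
  have h1 : (extChartAt I (1 : G)).symm ⁻¹' Set.range (fun x : G => x ^ n) ∈
      𝓝 (extChartAt I (1 : G) 1) := by
    rw [← hmap, Filter.mem_map]
    filter_upwards [eventually_pow_mem_source I G n] with x hx
    exact ⟨(extChartAt I (1 : G)).symm x, ((extChartAt I (1 : G)).left_inv hx).symm⟩
  filter_upwards [(continuousAt_extChartAt (I := I) (1 : G)).preimage_mem_nhds h1,
    extChartAt_source_mem_nhds (I := I) (1 : G)] with g hg hs
  rwa [Set.mem_preimage, Set.mem_preimage, (extChartAt I (1 : G)).left_inv hs] at hg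

end LiePowers

/-! ### Commutator subgroups of finitely generated nilpotent and pro-`p` groups -/

section Commutators

open scoped commutatorElement

/-- The product, in the order of a fixed enumeration of `ι`, of the commutators `⁅y i, x i⁆`. -/
def commutatorProd {ι : Type*} [Fintype ι] {Q : Type*} [Group Q] (x y : ι → Q) : Q :=
  (Finset.univ.toList.map fun i => ⁅y i, x i⁆).prod

theorem commutatorProd_mem {ι : Type*} [Fintype ι] {Q : Type*} [Group Q] (x y : ι → Q) :
    commutatorProd x y ∈ commutator Q := by
  refine Subgroup.list_prod_mem _ fun q hq => ?_
  obtain ⟨i, -, rfl⟩ := List.mem_map.1 hq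
  exact Subgroup.commutator_mem_commutator (Subgroup.mem_top _) (Subgroup.mem_top _)

theorem map_commutatorProd {ι : Type*} [Fintype ι] {Q R : Type*} [Group Q] [Group R]
    (f : Q →* R) (x y : ι → Q) :
    f (commutatorProd x y) = commutatorProd (f ∘ x) (f ∘ y) := by
  simp [commutatorProd, map_list_prod, Function.comp_def, map_commutatorElement]

theorem list_prod_map_mul_of_mem_center {ι Q : Type*} [Group Q] (l : List ι) (a b : ι → Q)
    (hb : ∀ i, b i ∈ Subgroup.center Q) :
    (l.map fun i => b i * a i).prod = (l.map a).prod * (l.map b).prod := by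
  induction l with
  | nil => simp
  | cons i l ih =>
    have h := Subgroup.mem_center_iff.1 (hb i)
    simp only [List.map_cons, List.prod_cons, ih]
    rw [← h (a i), mul_assoc, mul_assoc, ← mul_assoc (b i), ← h, mul_assoc]

/-- If the last nontrivial step `⁅L, Q⁆` of the lower central series is central, the commutator is
bimultiplicative on `L × Q`, so that `⁅L, Q⁆` consists of products of commutators with the
generators. -/
theorem exists_commutatorProd_eq_of_le_center {ι : Type*} [Fintype ι] {Q : Type*} [Group Q]
    (x : ι → Q) (hx : Subgroup.closure (Set.range x) = ⊤) (L : Subgroup Q)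
    (hL : ⁅L, (⊤ : Subgroup Q)⁆ ≤ Subgroup.center Q) {z : Q} (hz : z ∈ ⁅L, (⊤ : Subgroup Q)⁆) :
    ∃ u : ι → Q, (∀ i, u i ∈ L) ∧ commutatorProd x u = z := by
  classical
  have hc : ∀ u ∈ L, ∀ q r : Q, r * ⁅u, q⁆ = ⁅u, q⁆ * r := fun u hu q r =>
    Subgroup.mem_center_iff.1
      (hL (Subgroup.commutator_mem_commutator hu (Subgroup.mem_top q))) r
  have hmulL : ∀ u ∈ L, ∀ v ∈ L, ∀ q : Q, ⁅u * v, q⁆ = ⁅u, q⁆ * ⁅v, q⁆ := by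
    intro u hu v hv q
    have h := hc v hv q u
    have e : ⁅u * v, q⁆ = u * ⁅v, q⁆ * u⁻¹ * ⁅u, q⁆ := by
      simp only [commutatorElement_def]; group
    rw [e, h, mul_inv_cancel_right, hc v hv q]
  have hmulR : ∀ u ∈ L, ∀ q r : Q, ⁅u, q * r⁆ = ⁅u, q⁆ * ⁅u, r⁆ := by
    intro u hu q r
    have h := hc u hu r q
    have e : ⁅u, q * r⁆ = ⁅u, q⁆ * (q * ⁅u, r⁆ * q⁻¹) := by
      simp only [commutatorElement_def]; group
    rw [e, h, mul_inv_cancel_right]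
  let _ : CommGroup (Subgroup.center Q) :=
    { (inferInstance : Group (Subgroup.center Q)) with
      mul_comm := fun a b => Subtype.ext (Subgroup.mem_center_iff.1 b.2 a) }
  let β : ι → L →* Subgroup.center Q := fun i =>
    { toFun := fun u => ⟨⁅(u : Q), x i⁆,
        hL (Subgroup.commutator_mem_commutator u.2 (Subgroup.mem_top _))⟩
      map_one' := Subtype.ext (commutatorElement_one_left _)
      map_mul' := fun u v => Subtype.ext (hmulL u u.2 v v.2 _) }
  let B : (ι → L) →* Subgroup.center Q :=
    { toFun := fun u => ∏ i, β i (u i)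
      map_one' := by simp
      map_mul' := fun u v => by simp [Finset.prod_mul_distrib] }
  have hB : ∀ u : ι → L, (B u : Q) = commutatorProd x fun i => (u i : Q) := by
    intro u
    change ((Subgroup.center Q).subtype (∏ i, β i (u i))) = _
    rw [← Finset.prod_map_toList, map_list_prod, List.map_map]
    rfl
  have key : ∀ q : Q, ∀ u ∈ L, ⁅u, q⁆ ∈ B.range.map (Subgroup.center Q).subtype := by
    intro q
    have hq : q ∈ Subgroup.closure (Set.range x) := hx ▸ Subgroup.mem_top q
    induction hq using Subgroup.closure_induction with
    | mem q hq =>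
      obtain ⟨i, rfl⟩ := hq
      intro u hu
      refine ⟨B (Pi.mulSingle i ⟨u, hu⟩), ⟨_, rfl⟩, ?_⟩
      have : B (Pi.mulSingle i ⟨u, hu⟩) = β i ⟨u, hu⟩ := by
        change ∏ j, β j _ = _
        rw [Finset.prod_eq_single i]
        · rw [Pi.mulSingle_eq_same]
        · intro j _ hj
          rw [Pi.mulSingle_eq_of_ne hj, map_one]
        · simp
      rw [this]
      rfl
    | one =>
      intro u _
      rw [commutatorElement_one_right]
      exact one_mem _
    | mul q r _ _ h1 h2 =>
      intro u hu
      rw [hmulR u hu]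
      exact mul_mem (h1 u hu) (h2 u hu)
    | inv q _ h =>
      intro u hu
      have e := hmulR u hu q q⁻¹
      rw [mul_inv_cancel, commutatorElement_one_right] at e
      rw [eq_inv_of_mul_eq_one_right e.symm]
      exact inv_mem (h u hu)
  have hle : ⁅L, (⊤ : Subgroup Q)⁆ ≤ B.range.map (Subgroup.center Q).subtype :=
    Subgroup.commutator_le.2 fun u hu q _ => key q u hu
  obtain ⟨_, ⟨u, rfl⟩, h⟩ := hle hz
  exact ⟨fun i => u i, fun i => (u i).2, (hB u).symm.trans h⟩

/-- In a nilpotent group generated by finitely many elements `x i`, every element of the commutator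
subgroup is a product of commutators `⁅y i, x i⁆`, one for each generator. -/
theorem exists_commutatorProd_eq {ι : Type*} [Fintype ι] (c : ℕ) :
    ∀ {Q : Type*} [Group Q] (x : ι → Q) (_ : Subgroup.closure (Set.range x) = ⊤)
      (_ : (⊤ : Subgroup Q).lowerCentralSeries (c + 1) = ⊥) {q : Q} (_ : q ∈ commutator Q),
      ∃ y : ι → Q, commutatorProd x y = q := by
  induction c with
  | zero =>
    intro Q _ x _ hQ q hq
    rw [Subgroup.top_lowerCentralSeries_one] at hQ
    rw [hQ, Subgroup.mem_bot] at hq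
    refine ⟨1, ?_⟩
    have h := commutatorProd_mem x 1
    rw [hQ, Subgroup.mem_bot] at h
    rw [h, hq]
  | succ c ih =>
    intro Q _ x hx hQ q hq
    set N := (⊤ : Subgroup Q).lowerCentralSeries (c + 1) with hN
    have hNc : N ≤ Subgroup.center Q := by
      intro n hn
      refine Subgroup.mem_center_iff.2 fun g => ?_
      have h : ⁅n, g⁆ ∈ (⊤ : Subgroup Q).lowerCentralSeries (c + 1 + 1) :=
        Subgroup.commutator_mem_commutator hn (Subgroup.mem_top g)
      rw [hQ, Subgroup.mem_bot, commutatorElement_eq_one_iff_mul_comm] at h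
      exact h.symm
    have hxN : Subgroup.closure (Set.range (QuotientGroup.mk' N ∘ x)) = ⊤ := by
      rw [Set.range_comp, ← MonoidHom.map_closure, hx,
        Subgroup.map_top_of_surjective _ (QuotientGroup.mk'_surjective N)]
    have hlN : (⊤ : Subgroup (Q ⧸ N)).lowerCentralSeries (c + 1) = ⊥ := by
      rw [← Subgroup.map_top_of_surjective _ (QuotientGroup.mk'_surjective N),
        ← Subgroup.map_lowerCentralSeries, ← hN, QuotientGroup.map_mk'_self]
    have hqN : (QuotientGroup.mk' N) q ∈ commutator (Q ⧸ N) := by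
      have h : (commutator Q).map (QuotientGroup.mk' N) ≤ commutator (Q ⧸ N) := by
        rw [commutator_def, Subgroup.map_commutator]
        exact Subgroup.commutator_mono le_top le_top
      exact h ⟨q, hq, rfl⟩
    obtain ⟨y', hy'⟩ := ih _ hxN hlN hqN
    choose y hy using fun i => QuotientGroup.mk'_surjective N (y' i)
    obtain rfl : QuotientGroup.mk' N ∘ y = y' := funext hy
    rw [← map_commutatorProd] at hy'
    have hz : (commutatorProd x y)⁻¹ * q ∈ N := QuotientGroup.eq.1 hy'
    obtain ⟨u, hu, huz⟩ := exists_commutatorProd_eq_of_le_center x hx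
      ((⊤ : Subgroup Q).lowerCentralSeries c) hNc hz
    have hcent : ∀ i r, r * ⁅u i, x i⁆ = ⁅u i, x i⁆ * r := fun i r =>
      Subgroup.mem_center_iff.1
        (hNc (Subgroup.commutator_mem_commutator (hu i) (Subgroup.mem_top _))) r
    -- the `⁅u i, x i⁆` are central, so that correcting `y i` to `y i * u i` multiplies by their product
    refine ⟨fun i => y i * u i, ?_⟩
    have e : ∀ i, ⁅y i * u i, x i⁆ = ⁅u i, x i⁆ * ⁅y i, x i⁆ := by
      intro i
      have e : ⁅y i * u i, x i⁆ = y i * ⁅u i, x i⁆ * (y i)⁻¹ * ⁅y i, x i⁆ := by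
        simp only [commutatorElement_def]; group
      rw [e, hcent, mul_inv_cancel_right]
    have h2 := list_prod_map_mul_of_mem_center Finset.univ.toList
      (fun i => ⁅y i, x i⁆) (fun i => ⁅u i, x i⁆)
      fun i => Subgroup.mem_center_iff.2 (hcent i)
    have h3 : commutatorProd x (fun i => y i * u i) = commutatorProd x y * commutatorProd x u := by
      simp only [commutatorProd, e]
      exact h2
    rw [h3, huz, mul_inv_cancel_left]

/-- A finite `p`-group is generated by any set which generates it modulo a subgroup generated by
`p`-th powers, since every maximal subgroup is normal of index `p`. -/
theorem closure_range_eq_top_of_isPGroup {ι Q : Type*} [Group Q] [Finite Q] {p : ℕ}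
    [hp : Fact p.Prime] (hQ : IsPGroup p Q) (x : ι → Q)
    (hx : ∀ q, ∃ i, (x i)⁻¹ * q ∈ Subgroup.closure (Set.range fun r : Q => r ^ p)) :
    Subgroup.closure (Set.range x) = ⊤ := by
  refine (eq_top_or_exists_le_coatom (Subgroup.closure (Set.range x))).resolve_right ?_
  rintro ⟨M, hM, hxM⟩
  have : Group.IsNilpotent Q := hQ.isNilpotent
  have hN : M.Normal := Subgroup.NormalizerCondition.normal_of_coatom M
    Group.normalizerCondition_of_isNilpotent hM
  have hpow : ∀ r : Q, r ^ p ∈ M := by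
    intro r
    by_contra h
    have hs : M ⊔ Subgroup.zpowers (r ^ p) = ⊤ :=
      hM.2 _ (lt_of_le_of_ne le_sup_left fun e => h (e ▸ Subgroup.mem_sup_right
        (Subgroup.mem_zpowers _)))
    have hr : r ∈ M ⊔ Subgroup.zpowers (r ^ p) := hs ▸ Subgroup.mem_top r
    obtain ⟨m, hm, _, ⟨k, rfl⟩, e⟩ := Subgroup.mem_sup_of_normal_left.1 hr
    -- the image of `r` in `Q ⧸ M` is a power of its own `p`-th power
    have h1 : (r : Q ⧸ M) ^ (p * k - 1) = 1 := by
      have e' : (r : Q ⧸ M) = (r : Q ⧸ M) ^ (p * k) := by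
        conv_lhs => rw [← e]
        rw [QuotientGroup.mk_mul, (QuotientGroup.eq_one_iff m).2 hm, one_mul]
        simp [zpow_mul]
      rw [zpow_sub_one, ← e', mul_inv_cancel]
    obtain ⟨n, hn⟩ := (hQ.to_quotient M) (r : Q ⧸ M)
    have hcop : IsCoprime ((p : ℤ) ^ n) (p * k - 1) :=
      IsCoprime.pow_left ⟨k, -1, by ring⟩
    obtain ⟨a, b, hab⟩ := hcop
    have h2 : (r : Q ⧸ M) = 1 := by
      rw [← zpow_one (r : Q ⧸ M), ← hab, zpow_add, mul_comm a, mul_comm b, zpow_mul, zpow_mul, h1,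
        one_zpow, mul_one]
      have h3 : (r : Q ⧸ M) ^ ((p : ℤ) ^ n) = 1 := by exact_mod_cast hn
      rw [h3, one_zpow]
    exact h (pow_mem ((QuotientGroup.eq_one_iff r).1 h2) p)
  refine hM.1 (eq_top_iff.2 fun q _ => ?_)
  obtain ⟨i, hi⟩ := hx q
  have h1 : Subgroup.closure (Set.range fun r : Q => r ^ p) ≤ M :=
    (Subgroup.closure_le M).2 (Set.range_subset_iff.2 hpow)
  have h2 := mul_mem (hxM (Subgroup.subset_closure ⟨i, rfl⟩)) (h1 hi)
  rwa [mul_inv_cancel_left] at h2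

variable (p : ℕ) {G : Type*} [Group G] [TopologicalSpace G]

theorem IsProPGroup.isPGroup_quotient (hG : IsProPGroup p G) (N : Subgroup G) [hN : N.Normal]
    (hU : IsOpen (N : Set G)) : IsPGroup p (G ⧸ N) := by
  obtain ⟨n, hn⟩ := hG.index_eq N hN hU
  exact IsPGroup.of_card hn

theorem IsProPGroup.finite_quotient (hG : IsProPGroup p G) (N : Subgroup G)
    (hU : IsOpen (N : Set G)) : Finite (G ⧸ N) := by
  have := hG.compactSpace
  have := hG.isTopologicalGroup
  exact Subgroup.quotient_finite_of_isOpen N hU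

/-- If the `p`-th powers of a pro-`p` group `G` fill a neighbourhood of the identity, then `G` is
topologically finitely generated, and its abstract commutator subgroup is closed: it is the image
of the compact space of families `y` under the product of the commutators `⁅y i, x i⁆` with the
generators. -/
theorem IsProPGroup.isClosed_commutator [Fact p.Prime] (hG : IsProPGroup p G)
    (hpow : Set.range (fun x : G => x ^ p) ∈ nhds (1 : G)) :
    IsClosed (commutator G : Set G) := by
  have := hG.compactSpace
  have := hG.t2Space
  have := hG.totallyDisconnectedSpace
  have := hG.isTopologicalGroup
  set P : Subgroup G := Subgroup.closure (Set.range fun x : G => x ^ p) with hP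
  have hPo : IsOpen (P : Set G) :=
    Subgroup.isOpen_of_mem_nhds P (Filter.mem_of_superset hpow Subgroup.subset_closure)
  have : Finite (G ⧸ P) := hG.finite_quotient p P hPo
  have : Fintype (G ⧸ P) := Fintype.ofFinite _
  let x : G ⧸ P → G := Quotient.out
  have hcont : Continuous fun y : G ⧸ P → G => commutatorProd x y := by
    refine continuous_list_prod _ fun i _ => ?_
    simp only [commutatorElement_def]
    fun_prop
  have hT : IsClosed (Set.range fun y : G ⧸ P → G => commutatorProd x y) :=
    (isCompact_range hcont).isClosed
  have heq : closure (commutator G : Set G) ⊆ Set.range fun y : G ⧸ P → G => commutatorProd x y := by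
    intro g hg
    by_contra hgT
    have hW : IsOpen ((fun h => g * h) ⁻¹' (Set.range fun y : G ⧸ P → G => commutatorProd x y)ᶜ) :=
      hT.isOpen_compl.preimage (continuous_const_mul g)
    obtain ⟨N, hN⟩ := ProfiniteGrp.exist_openNormalSubgroup_sub_open_nhds_of_one hW (by simpa using hgT)
    have hNo : IsOpen ((N : Subgroup G) : Set G) := N.isOpen
    have : Finite (G ⧸ (N : Subgroup G)) := hG.finite_quotient p _ hNo
    have hpg := hG.isPGroup_quotient p (N : Subgroup G) hNo
    have hnil : Group.IsNilpotent (G ⧸ (N : Subgroup G)) := hpg.isNilpotent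
    let π := QuotientGroup.mk' (N : Subgroup G)
    have hgen : Subgroup.closure (Set.range (π ∘ x)) = ⊤ := by
      refine closure_range_eq_top_of_isPGroup hpg _ fun q => ?_
      obtain ⟨q, rfl⟩ := QuotientGroup.mk'_surjective (N : Subgroup G) q
      refine ⟨(q : G ⧸ P), ?_⟩
      have h1 : (x (q : G ⧸ P))⁻¹ * q ∈ P := QuotientGroup.eq.1 (Quotient.out_eq _)
      have h2 : P.map π ≤ Subgroup.closure (Set.range fun r : G ⧸ (N : Subgroup G) => r ^ p) := by
        rw [hP, MonoidHom.map_closure]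
        refine Subgroup.closure_mono ?_
        rintro _ ⟨_, ⟨r, rfl⟩, rfl⟩
        exact ⟨π r, (map_pow π r p).symm⟩
      exact h2 ⟨_, h1, by simp [π]⟩
    obtain ⟨c, hc⟩ := Subgroup.nilpotent_iff_lowerCentralSeries.1 hnil
    have hc' : (⊤ : Subgroup (G ⧸ (N : Subgroup G))).lowerCentralSeries (c + 1) = ⊥ :=
      eq_bot_iff.2 (hc ▸ Subgroup.lowerCentralSeries_antitone _ (Nat.le_succ c))
    -- the class of `g` modulo `N` is a product of commutators
    have hgN : IsOpen ((fun h => g⁻¹ * h) ⁻¹' ((N : Subgroup G) : Set G)) :=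
      hNo.preimage (continuous_const_mul g⁻¹)
    obtain ⟨h, hh1, hh2⟩ := mem_closure_iff.1 hg _ hgN (by simp)
    have hgh : π g = π h := QuotientGroup.eq.2 hh1
    have hcomm : π h ∈ commutator (G ⧸ (N : Subgroup G)) := by
      have h : (commutator G).map π ≤ commutator (G ⧸ (N : Subgroup G)) := by
        rw [commutator_def, Subgroup.map_commutator]
        exact Subgroup.commutator_mono le_top le_top
      exact h ⟨_, hh2, rfl⟩
    obtain ⟨y', hy'⟩ := exists_commutatorProd_eq c _ hgen hc' hcomm
    choose y hy using fun i => QuotientGroup.mk'_surjective (N : Subgroup G) (y' i)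
    obtain rfl : π ∘ y = y' := funext hy
    rw [← map_commutatorProd, ← hgh] at hy'
    have hz : g⁻¹ * commutatorProd x y ∈ (N : Subgroup G) := QuotientGroup.eq.1 hy'.symm
    have := hN hz
    simp at this
  have : closure (commutator G : Set G) = commutator G :=
    Set.Subset.antisymm (heq.trans (Set.range_subset_iff.2 fun y => commutatorProd_mem x y))
      subset_closure
  exact this ▸ isClosed_closure

end Commutators

/-! ### Characters, one-dimensional representations and restriction -/

namespace SmoothRep

variable {K : Type u} [Field K] {G : Type v} [Group G] [TopologicalSpace G]

/-- The one-dimensional representation given by a character which is trivial on an open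
subgroup. -/
def line (χ : G →* Kˣ) (hχ : ∃ U : OpenSubgroup G, ∀ g ∈ U, χ g = 1) : SmoothRep K G where
  V := K
  ρ := (algebraMap K (Module.End K K)).toMonoidHom.comp ((Units.coeHom K).comp χ)
  smooth := by
    obtain ⟨U, hU⟩ := hχ
    exact ⟨U, fun g hg => by simp [hU g hg]⟩

/-- The determinant character of a representation. -/
def detChar (A : SmoothRep K G) : G →* Kˣ := (Units.map LinearMap.det).comp A.ρ.asGroupHom

theorem smooth_detChar (A : SmoothRep K G) : ∃ U : OpenSubgroup G, ∀ g ∈ U, A.detChar g = 1 := by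
  obtain ⟨U, hU⟩ := A.smooth
  refine ⟨U, fun g hg => Units.ext ?_⟩
  change LinearMap.det (A.ρ g) = 1
  rw [hU g hg, map_one]

theorem detChar_line (χ : G →* Kˣ) (hχ : ∃ U : OpenSubgroup G, ∀ g ∈ U, χ g = 1) :
    (line χ hχ).detChar = χ := by
  refine MonoidHom.ext fun g => Units.ext ?_
  change LinearMap.det ((χ g : K) • (LinearMap.id : K →ₗ[K] K)) = _
  rw [LinearMap.det_smul, LinearMap.det_id, Module.finrank_self, pow_one, mul_one]

/-- A one-dimensional representation is given by its determinant character. -/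
theorem equiv_line_of_finrank_eq_one (A : SmoothRep K G) (hA : Module.finrank K A.V = 1) :
    A ≈ line A.detChar A.smooth_detChar := by
  have e : A.V ≃ₗ[K] K := LinearEquiv.ofFinrankEq A.V K (by rw [hA, Module.finrank_self])
  refine equiv_of (B := line A.detChar A.smooth_detChar) e fun g => LinearMap.ext fun x => ?_
  have hc : ∃ c : K, A.ρ g = c • LinearMap.id := by
    refine ⟨e (A.ρ g (e.symm 1)), LinearMap.ext fun x => e.injective ?_⟩
    have hx : x = e x • e.symm 1 := e.injective (by simp)
    rw [LinearMap.smul_apply, LinearMap.id_apply, map_smul, hx, map_smul, map_smul, map_smul]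
    simp [mul_comm]
  obtain ⟨c, hc⟩ := hc
  have hd : (A.detChar g : K) = c := by
    change LinearMap.det (A.ρ g) = c
    rw [hc, LinearMap.det_smul, LinearMap.det_id, hA, pow_one, mul_one]
  change e (A.ρ g x) = (A.detChar g : K) * e x
  rw [hd, hc, LinearMap.smul_apply, LinearMap.id_apply, map_smul, smul_eq_mul]

variable {H : Type w} [Group H] [TopologicalSpace H]

/-- The restriction of a representation along a continuous homomorphism. -/
def restrict (φ : H →* G) (hφ : Continuous φ) (A : SmoothRep K G) : SmoothRep K H where
  V := A.V
  ρ := A.ρ.comp φ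
  smooth := by
    obtain ⟨U, hU⟩ := A.smooth
    exact ⟨U.comap φ hφ, fun g hg => hU _ hg⟩

end SmoothRep

namespace RepRing

variable {K : Type u} [Field K] {G : Type v} [Group G] [TopologicalSpace G]

/-- The class of a one-dimensional representation. -/
def lineClass (χ : G →* Kˣ) (hχ : ∃ U : OpenSubgroup G, ∀ g ∈ U, χ g = 1) : RepRing K G :=
  ofRep (SmoothRep.line χ hχ)

theorem ofRep_eq_of_equiv {A B : SmoothRep K G} (h : A ≈ B) : ofRep A = ofRep B :=
  congrArg cls (Quotient.sound h)

theorem ofRep_mul (A B : SmoothRep K G) : ofRep A * ofRep B = ofRep (A.tensor B) :=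
  (cls_mul _ _).symm

theorem ofRep_induction {P : RepRing K G → Prop} (h1 : ∀ A : SmoothRep K G, P (ofRep A))
    (h2 : ∀ x y, P x → P y → P (x + y)) (h3 : ∀ x, P x → P (-x)) (x : RepRing K G) : P x :=
  RepRing.induction (fun a => Quotient.inductionOn a h1) h2 h3 x

theorem hom_ext_ofRep {A : Type*} [AddCommGroup A] {f g : RepRing K G →+ A}
    (h : ∀ B, f (ofRep B) = g (ofRep B)) : f = g :=
  hom_ext fun a => Quotient.inductionOn a h

theorem lift_ofRep {A : Type*} [AddCommGroup A] (f : RepClass K G →+ A) (B : SmoothRep K G) :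
    lift f (ofRep B) = f (RepClass.mk B) :=
  lift_cls _ _

theorem ofRep_eq_zero (A : SmoothRep K G) (hA : Module.finrank K A.V = 0) : ofRep A = 0 := by
  have : Subsingleton A.V := Module.finrank_zero_iff.1 hA
  have h : A ≈ SmoothRep.zero :=
    SmoothRep.equiv_of (B := SmoothRep.zero) (0 : A.V ≃ₗ[K] PUnit.{u + 1}) fun _ => rfl
  rw [ofRep_eq_of_equiv h]
  exact map_zero cls

theorem lineClass_one :
    lineClass (1 : G →* Kˣ) ⟨⊤, fun _ _ => rfl⟩ = (1 : RepRing K G) := by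
  refine ofRep_eq_of_equiv (A := SmoothRep.line 1 _) (B := SmoothRep.one)
    (SmoothRep.equiv_of (A := SmoothRep.line 1 _) (B := SmoothRep.one) (LinearEquiv.refl K K)
      fun g => LinearMap.ext fun x => ?_)
  exact one_mul (show K from x)

theorem smooth_mul {χ ψ : G →* Kˣ} (hχ : ∃ U : OpenSubgroup G, ∀ g ∈ U, χ g = 1)
    (hψ : ∃ U : OpenSubgroup G, ∀ g ∈ U, ψ g = 1) :
    ∃ U : OpenSubgroup G, ∀ g ∈ U, (χ * ψ) g = 1 := by
  obtain ⟨U, hU⟩ := hχ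
  obtain ⟨W, hW⟩ := hψ
  exact ⟨U ⊓ W, fun g hg => by rw [MonoidHom.mul_apply, hU g hg.1, hW g hg.2, one_mul]⟩

theorem smooth_inv {χ : G →* Kˣ} (hχ : ∃ U : OpenSubgroup G, ∀ g ∈ U, χ g = 1) :
    ∃ U : OpenSubgroup G, ∀ g ∈ U, χ⁻¹ g = 1 := by
  obtain ⟨U, hU⟩ := hχ
  exact ⟨U, fun g hg => by rw [MonoidHom.inv_apply, hU g hg, inv_one]⟩

theorem lineClass_mul {χ ψ : G →* Kˣ} (hχ : ∃ U : OpenSubgroup G, ∀ g ∈ U, χ g = 1)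
    (hψ : ∃ U : OpenSubgroup G, ∀ g ∈ U, ψ g = 1) :
    lineClass (χ * ψ) (smooth_mul hχ hψ) = lineClass χ hχ * lineClass ψ hψ := by
  have key : ∀ a b : K, (TensorProduct.lid K K).toLinearMap ∘ₗ
      TensorProduct.map (a • (LinearMap.id : K →ₗ[K] K)) (b • (LinearMap.id : K →ₗ[K] K)) =
      ((a * b) • (LinearMap.id : K →ₗ[K] K)) ∘ₗ (TensorProduct.lid K K).toLinearMap := by
    intro a b
    ext
    simp
  have h := SmoothRep.equiv_of (A := (SmoothRep.line χ hχ).tensor (SmoothRep.line ψ hψ))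
    (B := SmoothRep.line (χ * ψ) (smooth_mul hχ hψ)) (TensorProduct.lid K K)
    fun g => key (χ g) (ψ g)
  exact (ofRep_eq_of_equiv h).symm.trans (ofRep_mul _ _).symm

theorem ofRep_eq_lineClass (A : SmoothRep K G) (hA : Module.finrank K A.V = 1) :
    ofRep A = lineClass A.detChar A.smooth_detChar :=
  ofRep_eq_of_equiv (A.equiv_line_of_finrank_eq_one hA)

theorem augmentation_ofRep (A : SmoothRep K G) :
    augmentation (ofRep A) = (Module.finrank K A.V : ℤ) :=
  lift_cls _ _

theorem det_ofRep (g : G) (A : SmoothRep K G) :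
    det g (ofRep A) = Additive.ofMul (A.detChar g) :=
  lift_cls _ _

theorem traceHom_ofRep (g : G) (A : SmoothRep K G) :
    traceHom g (ofRep A) = LinearMap.trace K A.V (A.ρ g) :=
  lift_cls _ _

theorem augmentation_lineClass (χ : G →* Kˣ) (hχ : ∃ U : OpenSubgroup G, ∀ g ∈ U, χ g = 1) :
    augmentation (lineClass χ hχ) = 1 := by
  rw [lineClass, augmentation_ofRep]
  exact congrArg Nat.cast (Module.finrank_self K)

theorem det_lineClass (g : G) (χ : G →* Kˣ) (hχ : ∃ U : OpenSubgroup G, ∀ g ∈ U, χ g = 1) :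
    det g (lineClass χ hχ) = Additive.ofMul (χ g) := by
  rw [lineClass, det_ofRep, SmoothRep.detChar_line]

theorem det_one (g : G) : det g (1 : RepRing K G) = 0 := by
  rw [← lineClass_one, det_lineClass]
  rfl

theorem traceHom_lineClass (g : G) (χ : G →* Kˣ)
    (hχ : ∃ U : OpenSubgroup G, ∀ g ∈ U, χ g = 1) : traceHom g (lineClass χ hχ) = (χ g : K) := by
  rw [lineClass, traceHom_ofRep]
  change LinearMap.trace K K ((χ g : K) • (LinearMap.id : K →ₗ[K] K)) = _
  rw [map_smul, LinearMap.trace_id, Module.finrank_self]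
  simp

/-- The determinant of a tensor product. -/
theorem det_mul (g : G) (x y : RepRing K G) :
    det g (x * y) = augmentation y • det g x + augmentation x • det g y := by
  induction x using ofRep_induction with
  | h1 A =>
    induction y using ofRep_induction with
    | h1 B =>
      have h : LinearMap.det (TensorProduct.map (A.ρ g) (B.ρ g)) =
          LinearMap.det (A.ρ g) ^ Module.finrank K B.V *
            LinearMap.det (B.ρ g) ^ Module.finrank K A.V := by
        let bA := Module.finBasis K A.V
        let bB := Module.finBasis K B.V
        rw [← LinearMap.det_toMatrix (bA.tensorProduct bB), TensorProduct.toMatrix_map,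
          Matrix.det_kronecker, LinearMap.det_toMatrix, LinearMap.det_toMatrix, Fintype.card_fin,
          Fintype.card_fin]
      have h' : (A.tensor B).detChar g =
          A.detChar g ^ Module.finrank K B.V * B.detChar g ^ Module.finrank K A.V := by
        refine Units.ext ?_
        rw [Units.val_mul, Units.val_pow_eq_pow_val, Units.val_pow_eq_pow_val]
        exact h
      rw [ofRep_mul, augmentation_ofRep, augmentation_ofRep, det_ofRep, det_ofRep, det_ofRep,
        natCast_zsmul, natCast_zsmul, h', ofMul_mul, ofMul_pow, ofMul_pow]
    | h2 x y hx hy => rw [mul_add, map_add, map_add, map_add, hx, hy]; module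
    | h3 x hx => rw [mul_neg, map_neg, map_neg, map_neg, hx]; module
  | h2 x z hx hz => rw [add_mul, map_add, map_add, map_add, hx, hz]; module
  | h3 x hx => rw [neg_mul, map_neg, map_neg, map_neg, hx]; module

/-- The ideal of all virtual representations of dimension zero on which `g` has determinant
one. -/
def detIdeal (K : Type u) [Field K] {G : Type v} [Group G] [TopologicalSpace G] (g : G) :
    Ideal (RepRing K G) where
  carrier := {x | augmentation x = 0 ∧ det g x = 0}
  zero_mem' := ⟨map_zero _, map_zero _⟩
  add_mem' := fun ha hb => ⟨by rw [map_add, ha.1, hb.1, add_zero],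
    by rw [map_add, ha.2, hb.2, add_zero]⟩
  smul_mem' := fun c x hx => ⟨by rw [smul_eq_mul, map_mul, hx.1, mul_zero],
    by rw [smul_eq_mul, det_mul, hx.1, hx.2, zero_smul, smul_zero, add_zero]⟩

theorem mul_mem_detIdeal (g : G) {x y : RepRing K G} (hx : augmentation x = 0)
    (hy : augmentation y = 0) : x * y ∈ detIdeal K g :=
  ⟨by rw [map_mul, hx, zero_mul], by rw [det_mul, hx, hy, zero_smul, zero_smul, add_zero]⟩

section Lambda

open PowerSeries

theorem coeff_lambdaSeries_ofRep (A : SmoothRep K G) (n : ℕ) :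
    coeff n (lambdaSeries (ofRep A) : (RepRing K G)⟦X⟧) = ofRep (A.ext n) := by
  have h : lambdaHom (ofRep A) = Additive.ofMul (lambdaUnit (RepClass.mk A)) := lift_ofRep _ A
  rw [lambdaSeries, h, toMul_ofMul, coe_lambdaUnit, coeff_mk]
  rfl

end Lambda

section Restriction

variable {H : Type w} [Group H] [TopologicalSpace H] (φ : H →* G) (hφ : Continuous φ)

theorem restrict_congr {A B : SmoothRep K G} (h : A ≈ B) :
    A.restrict φ hφ ≈ B.restrict φ hφ := by
  obtain ⟨e, he⟩ := SmoothRep.exists_of_equiv h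
  exact ⟨.mk e fun g => he (φ g)⟩

/-- Restriction of virtual representations along a continuous homomorphism, as an additive map. -/
def resHom : RepRing K G →+ RepRing K H :=
  lift (cls.comp
    { toFun := Quotient.map (SmoothRep.restrict (K := K) φ hφ) fun _ _ => restrict_congr φ hφ
      map_zero' := rfl
      map_add' := fun a b => Quotient.inductionOn₂ a b fun _ _ => rfl })

theorem resHom_ofRep (A : SmoothRep K G) : resHom φ hφ (ofRep A) = ofRep (A.restrict φ hφ) :=
  lift_cls _ _

/-- Restriction of virtual representations along a continuous homomorphism. -/
def res : RepRing K G →+* RepRing K H :=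
  { resHom φ hφ with
    map_one' := resHom_ofRep φ hφ SmoothRep.one
    map_mul' := fun x y => by
      change resHom φ hφ (x * y) = resHom φ hφ x * resHom φ hφ y
      induction x using ofRep_induction with
      | h1 A =>
        induction y using ofRep_induction with
        | h1 B =>
          rw [ofRep_mul, resHom_ofRep, resHom_ofRep, resHom_ofRep, ofRep_mul]
          rfl
        | h2 x y hx hy => rw [mul_add, map_add, map_add, hx, hy, mul_add]
        | h3 x hx => rw [mul_neg, map_neg, map_neg, hx, mul_neg]
      | h2 x z hx hz => rw [add_mul, map_add, map_add, hx, hz, add_mul]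
      | h3 x hx => rw [neg_mul, map_neg, map_neg, hx, neg_mul] }

theorem res_ofRep (A : SmoothRep K G) : res φ hφ (ofRep A) = ofRep (A.restrict φ hφ) :=
  lift_cls _ _

theorem det_res (h : H) (x : RepRing K G) : det h (res φ hφ x) = det (φ h) x := by
  have e : (det h).comp (res (K := K) φ hφ).toAddMonoidHom = det (φ h) :=
    hom_ext_ofRep fun A => by
      change det h (res φ hφ (ofRep A)) = det (φ h) (ofRep A)
      rw [res_ofRep, det_ofRep, det_ofRep]
      exact congrArg Additive.ofMul (Units.ext rfl)
  exact DFunLike.congr_fun e x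

theorem traceHom_res (h : H) (x : RepRing K G) : traceHom h (res φ hφ x) = traceHom (φ h) x := by
  have e : (traceHom h).comp (res (K := K) φ hφ).toAddMonoidHom = traceHom (φ h) :=
    hom_ext_ofRep fun A => by
      change traceHom h (res φ hφ (ofRep A)) = traceHom (φ h) (ofRep A)
      rw [res_ofRep, traceHom_ofRep, traceHom_ofRep]
      rfl
  exact DFunLike.congr_fun e x

theorem augmentation_res (x : RepRing K G) : augmentation (res φ hφ x) = augmentation x := by
  have e : (augmentation (K := K) (G := H)).toAddMonoidHom.comp (res φ hφ).toAddMonoidHom =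
      (augmentation (K := K) (G := G)).toAddMonoidHom :=
    hom_ext_ofRep fun A => by
      change augmentation (res φ hφ (ofRep A)) = augmentation (ofRep A)
      rw [res_ofRep, augmentation_ofRep, augmentation_ofRep]
      rfl
  exact DFunLike.congr_fun e x

open PowerSeries

theorem map_lambdaSeries_res (x : RepRing K G) :
    Units.map (PowerSeries.map (res (K := K) φ hφ) : (RepRing K G)⟦X⟧ →* (RepRing K H)⟦X⟧)
      (lambdaSeries x) =
      lambdaSeries (res φ hφ x) := by
  have e : (MonoidHom.toAdditive (Units.map
      (PowerSeries.map (res (K := K) φ hφ) : (RepRing K G)⟦X⟧ →* (RepRing K H)⟦X⟧))).comp lambdaHom =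
      lambdaHom.comp (resHom (K := K) φ hφ) :=
    hom_ext_ofRep fun A => by
      refine congrArg Additive.ofMul (Units.ext (PowerSeries.ext fun n => ?_) :
        Units.map (PowerSeries.map (res (K := K) φ hφ) : (RepRing K G)⟦X⟧ →* (RepRing K H)⟦X⟧)
          (lambdaSeries (ofRep A)) = lambdaSeries (resHom φ hφ (ofRep A)))
      rw [Units.coe_map, resHom_ofRep, coeff_lambdaSeries_ofRep]
      change coeff n (PowerSeries.map (res φ hφ) (lambdaSeries (ofRep A) : (RepRing K G)⟦X⟧)) = _
      rw [PowerSeries.coeff_map, coeff_lambdaSeries_ofRep, res_ofRep]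
      rfl
  exact congrArg Additive.toMul (DFunLike.congr_fun e x)

theorem map_gammaSeries_res (x : RepRing K G) :
    PowerSeries.map (res (K := K) φ hφ) (gammaSeries x) = gammaSeries (res φ hφ x) := by
  have hs : HasSubst (X * PowerSeries.mk (fun _ => 1) : (RepRing K G)⟦X⟧) :=
    HasSubst.of_constantCoeff_zero' (by simp)
  have h : (PowerSeries.map (res (K := K) φ hφ)) (X * PowerSeries.mk (fun _ => 1)) =
      X * PowerSeries.mk (fun _ => 1) := by
    rw [map_mul, PowerSeries.map_X]
    congr 1
    ext n
    simp
  rw [gammaSeries, gammaSeries, ← map_lambdaSeries_res φ hφ]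
  refine (PowerSeries.map_subst hs (h := res (K := K) φ hφ) _).trans ?_
  exact congrArg (fun b => PowerSeries.subst b _) h

theorem res_gammaOp (n : ℕ) (x : RepRing K G) :
    res φ hφ (gammaOp n x) = gammaOp n (res φ hφ x) := by
  rw [gammaOp, gammaOp, ← map_gammaSeries_res, PowerSeries.coeff_map]

theorem res_adams (n : ℕ) (x : RepRing K G) :
    res φ hφ (adams n x) = adams n (res φ hφ x) := by
  change res φ hφ (coeff n (adamsSeries x)) = coeff n (adamsSeries (res φ hφ x))
  have hr : ∀ f : (RepRing K G)⟦X⟧, PowerSeries.map (res (K := K) φ hφ) (rescale (-1) f) =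
      rescale (-1) (PowerSeries.map (res φ hφ) f) := by
    intro f
    ext k
    simp
  have hd : ∀ f : (RepRing K G)⟦X⟧, PowerSeries.map (res (K := K) φ hφ)
      (derivative (RepRing K G) f) =
      derivative (RepRing K H) (PowerSeries.map (res φ hφ) f) := by
    intro f
    ext k
    rw [PowerSeries.coeff_map, coeff_derivative, coeff_derivative, PowerSeries.coeff_map]
    simp
  rw [← PowerSeries.coeff_map]
  congr 1
  rw [adamsSeries, adamsSeries, map_neg, map_mul, map_mul, hd, hr, hr, PowerSeries.map_X,
    ← map_lambdaSeries_res φ hφ x, ← map_inv]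
  rfl

end Restriction

end RepRing

/-! ### Lambda, gamma and Adams operations on sums of one-dimensional representations -/

namespace RepRing

open PowerSeries

variable {K : Type u} [Field K] {G : Type v} [Group G] [TopologicalSpace G]

theorem lineClass_congr {χ ψ : G →* Kˣ} (h : χ = ψ) {hχ : ∃ U : OpenSubgroup G, ∀ g ∈ U, χ g = 1}
    {hψ : ∃ U : OpenSubgroup G, ∀ g ∈ U, ψ g = 1} : lineClass χ hχ = lineClass ψ hψ := by
  subst h
  rfl

theorem hasSubst_X_mul_geom (R : Type*) [CommRing R] :
    HasSubst (X * PowerSeries.mk (fun _ => 1) : R⟦X⟧) :=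
  HasSubst.of_constantCoeff_zero' (by simp)

theorem lambdaSeries_add (x y : RepRing K G) :
    lambdaSeries (x + y) = lambdaSeries x * lambdaSeries y := by
  simp only [lambdaSeries, map_add, toMul_add]

theorem gammaSeries_add (x y : RepRing K G) :
    gammaSeries (x + y) = gammaSeries x * gammaSeries y := by
  rw [gammaSeries, lambdaSeries_add, Units.val_mul, subst_mul (hasSubst_X_mul_geom _)]
  rfl

theorem gammaSeries_zero : gammaSeries (0 : RepRing K G) = 1 := by
  have h : lambdaSeries (0 : RepRing K G) = 1 := by
    rw [lambdaSeries, map_zero, toMul_zero]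
  rw [gammaSeries, h, Units.val_one, ← coe_substAlgHom (hasSubst_X_mul_geom _), map_one]

theorem ofRep_ext_zero (A : SmoothRep K G) : ofRep (A.ext 0) = 1 :=
  congrArg cls (RepClass.ext_zero (RepClass.mk A))

theorem ofRep_ext_one (A : SmoothRep K G) : ofRep (A.ext 1) = ofRep A := by
  have key : ∀ f : A.V →ₗ[K] A.V, (exteriorPower.oneEquiv K A.V).toLinearMap ∘ₗ
      exteriorPower.map 1 f = f ∘ₗ (exteriorPower.oneEquiv K A.V).toLinearMap := by
    intro f
    refine exteriorPower.linearMap_ext ?_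
    ext v
    simp [exteriorPower.map_apply_ιMulti]
  exact ofRep_eq_of_equiv (SmoothRep.equiv_of (A := A.ext 1) (B := A)
    (exteriorPower.oneEquiv K A.V) fun g => key (A.ρ g))

theorem finrank_ext (A : SmoothRep K G) (n : ℕ) :
    Module.finrank K (A.ext n).V = (Module.finrank K A.V).choose n :=
  exteriorPower.finrank_eq K n

theorem ofRep_ext_eq_zero (A : SmoothRep K G) {n : ℕ} (hn : Module.finrank K A.V < n) :
    ofRep (A.ext n) = 0 :=
  ofRep_eq_zero _ (by rw [finrank_ext, Nat.choose_eq_zero_of_lt hn])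

theorem lambdaSeries_lineClass (χ : G →* Kˣ) (hχ : ∃ U : OpenSubgroup G, ∀ g ∈ U, χ g = 1) :
    (lambdaSeries (lineClass χ hχ) : (RepRing K G)⟦X⟧) = 1 + C (lineClass χ hχ) * X := by
  ext n
  rw [lineClass, coeff_lambdaSeries_ofRep]
  match n with
  | 0 => rw [ofRep_ext_zero]; simp
  | 1 => rw [ofRep_ext_one]; simp [coeff_one]
  | n + 2 =>
    have h : Module.finrank K (SmoothRep.line χ hχ).V = 1 := Module.finrank_self K
    rw [ofRep_ext_eq_zero _ (by omega)]
    simp [coeff_one]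

theorem gammaSeries_lineClass (χ : G →* Kˣ) (hχ : ∃ U : OpenSubgroup G, ∀ g ∈ U, χ g = 1) :
    gammaSeries (lineClass χ hχ) = 1 + C (lineClass χ hχ) * (X * PowerSeries.mk fun _ => 1) := by
  rw [gammaSeries, lambdaSeries_lineClass, ← coe_substAlgHom (hasSubst_X_mul_geom _), map_add,
    map_mul, map_one, coe_substAlgHom, subst_X (hasSubst_X_mul_geom _)]
  congr 2
  exact subst_C _

theorem gammaSeries_one : gammaSeries (1 : RepRing K G) = PowerSeries.mk fun _ => 1 := by
  rw [← lineClass_one, gammaSeries_lineClass, lineClass_one, map_one, one_mul]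
  have h := mk_one_mul_one_sub_eq_one (RepRing K G)
  linear_combination -h

theorem gammaSeries_natCast (n : ℕ) :
    gammaSeries (n : RepRing K G) = (PowerSeries.mk fun _ => 1) ^ n := by
  induction n with
  | zero => rw [Nat.cast_zero, gammaSeries_zero, pow_zero]
  | succ n ih => rw [Nat.cast_succ, gammaSeries_add, ih, gammaSeries_one, pow_succ]

theorem gammaSeries_sub_natCast (x : RepRing K G) (n : ℕ) :
    gammaSeries (x - (n : RepRing K G)) = gammaSeries x * (1 - X) ^ n := by
  have h1 : gammaSeries x = gammaSeries (x - (n : RepRing K G)) * (PowerSeries.mk fun _ => 1) ^ n := by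
    rw [← gammaSeries_natCast, ← gammaSeries_add, sub_add_cancel]
  have h2 : (PowerSeries.mk fun _ => 1 : (RepRing K G)⟦X⟧) * (1 - X) = 1 :=
    mk_one_mul_one_sub_eq_one _
  rw [h1, mul_assoc, ← mul_pow, h2, one_pow, mul_one]

theorem gammaSeries_lineClass_sub_one (χ : G →* Kˣ)
    (hχ : ∃ U : OpenSubgroup G, ∀ g ∈ U, χ g = 1) :
    gammaSeries (lineClass χ hχ - 1) = 1 + C (lineClass χ hχ - 1) * X := by
  have h := gammaSeries_sub_natCast (lineClass χ hχ) 1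
  have h2 := mk_one_mul_one_sub_eq_one (RepRing K G)
  rw [Nat.cast_one] at h
  rw [h, gammaSeries_lineClass, map_sub, map_one, pow_one]
  linear_combination C (lineClass χ hχ) * X * h2

/-- For a virtual sum `x` of one-dimensional representations, the total gamma operation of
`y = x - dim x` is `1 + y t` modulo the virtual representations of dimension zero on which `g` has
determinant one. It is exactly that for `x` one-dimensional, and both sides are multiplicative in
`x` because products of two elements of the augmentation ideal vanish in the quotient. -/
theorem map_gammaSeries_of_mem_closure (g : G) {x : RepRing K G}
    (hx : x ∈ AddSubgroup.closure {y | ∃ χ hχ, y = lineClass (K := K) (G := G) χ hχ}) :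
    PowerSeries.map (Ideal.Quotient.mk (detIdeal K g))
      (gammaSeries (x - (augmentation x : RepRing K G))) =
      1 + C (Ideal.Quotient.mk (detIdeal K g) (x - (augmentation x : RepRing K G))) * X := by
  have hI : ∀ y : RepRing K G, augmentation (y - (augmentation y : RepRing K G)) = 0 := by
    intro y
    rw [map_sub, map_intCast, Int.cast_id, sub_self]
  have hmul : ∀ y z : RepRing K G, augmentation y = 0 → augmentation z = 0 →
      Ideal.Quotient.mk (detIdeal K g) y * Ideal.Quotient.mk (detIdeal K g) z = 0 := by
    intro y z hy hz
    rw [← map_mul]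
    exact Ideal.Quotient.eq_zero_iff_mem.2 (mul_mem_detIdeal g hy hz)
  induction hx using AddSubgroup.closure_induction with
  | mem y hy =>
    obtain ⟨χ, hχ, rfl⟩ := hy
    rw [augmentation_lineClass, Int.cast_one, gammaSeries_lineClass_sub_one]
    simp
  | zero => simp [gammaSeries_zero]
  | add y z _ _ h1 h2 =>
    have e : y + z - ((augmentation (y + z) : ℤ) : RepRing K G) =
        (y - (augmentation y : RepRing K G)) + (z - (augmentation z : RepRing K G)) := by
      rw [map_add, Int.cast_add]
      ring
    have h3 := congrArg C (hmul _ _ (hI y) (hI z))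
    rw [map_mul, map_zero] at h3
    rw [e, gammaSeries_add, map_mul, h1, h2, map_add, map_add]
    linear_combination X ^ 2 * h3
  | neg y _ h1 =>
    have e : -y - ((augmentation (-y) : ℤ) : RepRing K G) =
        -(y - (augmentation y : RepRing K G)) := by
      rw [map_neg, Int.cast_neg]
      ring
    rw [e]
    set z := y - (augmentation y : RepRing K G) with hz
    have h2 : gammaSeries (-z) * gammaSeries z = 1 := by
      rw [← gammaSeries_add, neg_add_cancel, gammaSeries_zero]
    have h3 := congrArg (PowerSeries.map (Ideal.Quotient.mk (detIdeal K g))) h2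
    rw [map_mul, map_one, h1] at h3
    have h4 := congrArg C (hmul z z (hI y) (hI y))
    rw [map_mul, map_zero] at h4
    rw [map_neg, map_neg]
    linear_combination
      (1 - C (Ideal.Quotient.mk (detIdeal K g) z) * X) * h3 +
        X ^ 2 * PowerSeries.map (Ideal.Quotient.mk (detIdeal K g)) (gammaSeries (-z)) * h4

/-- The Adams operator `ψ^k` is the `k`-th power on one-dimensional representations. -/
theorem adams_lineClass {k : ℕ} (hk : k ≠ 0) (χ : G →* Kˣ)
    (hχ : ∃ U : OpenSubgroup G, ∀ g ∈ U, χ g = 1) :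
    adams k (lineClass χ hχ) = lineClass χ hχ ^ k := by
  set L := lineClass χ hχ with hL
  change coeff k (adamsSeries L) = L ^ k
  have h1 : rescale (-1) (lambdaSeries L : (RepRing K G)⟦X⟧) = 1 - C L * X := by
    rw [hL, lambdaSeries_lineClass, map_add, map_one, map_mul, rescale_X, map_neg, map_one]
    have : rescale (-1) (C (lineClass χ hχ)) = C (lineClass χ hχ) := by
      ext n
      rw [coeff_rescale, coeff_C]
      split_ifs with h <;> simp [h]
    rw [this]
    ring
  have h2 : (1 - C L * X) * rescale (-1) ((lambdaSeries L)⁻¹ : (RepRing K G)⟦X⟧ˣ).val = 1 := by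
    rw [← h1, ← map_mul, Units.mul_inv, map_one]
  have h3 : (1 - C L * X) * PowerSeries.mk (fun n => L ^ n) = 1 := by
    ext n
    rw [sub_mul, one_mul, map_sub, mul_assoc, coeff_C_mul]
    cases n with
    | zero => simp
    | succ n => simp [coeff_succ_X_mul, pow_succ', coeff_one]
  have h4 : rescale (-1) ((lambdaSeries L)⁻¹ : (RepRing K G)⟦X⟧ˣ).val =
      PowerSeries.mk (fun n => L ^ n) := by
    linear_combination PowerSeries.mk (fun n => L ^ n) * h2 -
      rescale (-1) ((lambdaSeries L)⁻¹ : (RepRing K G)⟦X⟧ˣ).val * h3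
  have h5 : derivative (RepRing K G) (1 - C L * X) = -C L := by
    rw [map_sub, Derivation.leibniz]
    simp
  obtain ⟨m, rfl⟩ := Nat.exists_eq_succ_of_ne_zero hk
  rw [adamsSeries, h1, h4, h5]
  rw [mul_neg, neg_mul, neg_neg, mul_assoc, coeff_succ_X_mul, coeff_C_mul, coeff_mk, pow_succ']

/-! ### Splitting along a cyclic subgroup -/

theorem zpowersHom_continuous (g : G) : Continuous (zpowersHom G g) := continuous_of_discreteTopology

theorem smooth_of_discrete {H : Type*} [Group H] [TopologicalSpace H] [DiscreteTopology H]
    (χ : H →* Kˣ) : ∃ U : OpenSubgroup H, ∀ g ∈ U, χ g = 1 :=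
  ⟨⟨⊥, isOpen_discrete _⟩, fun g hg => by
    rw [Subgroup.mem_bot.1 hg, map_one]⟩

/-- An endomorphism of finite order of a finite-dimensional vector space over an algebraically
closed field of characteristic zero has a basis of eigenvectors. -/
theorem exists_eigenbasis [IsAlgClosed K] [CharZero K] {V : Type*} [AddCommGroup V] [Module K V]
    [Module.Finite K V] (f : Module.End K V) {n : ℕ} (hn : n ≠ 0) (hf : f ^ n = 1) :
    ∃ (k : ℕ) (b : Module.Basis (Fin k) K V) (c : Fin k → K), ∀ i, f (b i) = c i • b i := by
  -- `X ^ n - 1` is separable in characteristic zero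
  have hs : f.IsSemisimple := by
    refine Module.End.isSemisimple_of_squarefree_aeval_eq_zero
      (p := (Polynomial.X ^ n - 1 : Polynomial K)) ?_ (by simp [hf])
    exact (Polynomial.separable_X_pow_sub_C (1 : K) (Nat.cast_ne_zero.2 hn) one_ne_zero).squarefree
  have htop : ⨆ μ, f.eigenspace μ = ⊤ := by
    rw [← Module.End.iSup_maxGenEigenspace_eq_top f]
    exact iSup_congr fun μ => (hs.isFinitelySemisimple.maxGenEigenspace_eq_eigenspace μ).symm
  have hspan : ⊤ ≤ Submodule.span K {v | ∃ c : K, f v = c • v} := by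
    rw [← htop]
    exact iSup_le fun μ v hv => Submodule.subset_span ⟨μ, Module.End.mem_eigenspace_iff.1 hv⟩
  let b := Module.Basis.ofSpan hspan
  have : Fintype _ := FiniteDimensional.fintypeBasisIndex b
  have hb : ∀ i, ∃ c : K, f (b i) = c • b i := fun i =>
    Module.Basis.ofSpan_subset hspan ⟨i, rfl⟩
  let e := Fintype.equivFin ((linearIndepOn_empty K id).extend
    (Set.empty_subset {v | ∃ c : K, f v = c • v}))
  choose c hc using hb
  exact ⟨_, b.reindex e, fun i => c (e.symm i), fun i => by simp [hc]⟩

/-- On an infinite cyclic group mapping to a compact group `G`, a representation of `G` becomes a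
sum of one-dimensional representations. -/
theorem res_zpowersHom_mem_closure [IsAlgClosed K] [CharZero K] [CompactSpace G]
    [IsTopologicalGroup G] (g : G) (x : RepRing K G) :
    res (zpowersHom G g) (zpowersHom_continuous g) x ∈ AddSubgroup.closure
      {y | ∃ χ hχ, y = lineClass (K := K) (G := Multiplicative ℤ) χ hχ} := by
  induction x using ofRep_induction with
  | h1 A =>
    rw [res_ofRep]
    set B := A.restrict (zpowersHom G g) (zpowersHom_continuous g) with hB
    obtain ⟨U, hU⟩ := A.smooth
    have : Finite (G ⧸ (U : Subgroup G)) := Subgroup.quotient_finite_of_isOpen _ U.isOpen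
    have hfi : (U : Subgroup G).FiniteIndex := Subgroup.finiteIndex_of_finite_quotient
    obtain ⟨n, hn, -, hgn⟩ := Subgroup.exists_pow_mem_of_index_ne_zero
      (hfi.index_ne_zero) g
    obtain ⟨k, b, c, hb⟩ := exists_eigenbasis (A.ρ g) hn.ne' (by rw [← map_pow, hU _ hgn])
    have hc : ∀ i, c i ≠ 0 := by
      intro i h0
      have h := hb i
      rw [h0, zero_smul] at h
      have h2 : A.ρ g⁻¹ (A.ρ g (b i)) = b i := A.ρ.inv_self_apply g (b i)
      rw [h, map_zero] at h2
      exact b.ne_zero i h2.symm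
    let χ : Fin k → Multiplicative ℤ →* Kˣ := fun i => zpowersHom Kˣ (Units.mk0 (c i) (hc i))
    have hχ : ∀ (m : Multiplicative ℤ) i, A.ρ (zpowersHom G g m) (b i) = ((χ i m : Kˣ) : K) • b i := by
      intro m i
      let S : Subgroup (Multiplicative ℤ) :=
        { carrier := {m | A.ρ (zpowersHom G g m) (b i) = ((χ i m : Kˣ) : K) • b i}
          one_mem' := by simp
          mul_mem' := fun {r s} hr hs => by
            change A.ρ (zpowersHom G g (r * s)) (b i) = _
            rw [map_mul, map_mul, Module.End.mul_apply, hs, map_smul, hr, smul_smul, map_mul,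
              Units.val_mul, mul_comm]
          inv_mem' := fun {r} hr => by
            change A.ρ (zpowersHom G g r⁻¹) (b i) = _
            have h := A.ρ.inv_self_apply (zpowersHom G g r) (b i)
            rw [hr, map_smul] at h
            rw [map_inv, map_inv (χ i), Units.val_inv_eq_inv_val, eq_inv_smul_iff₀ (Units.ne_zero _)]
            exact h }
      have hS : Subgroup.zpowers (Multiplicative.ofAdd (1 : ℤ)) ≤ S := by
        rw [Subgroup.zpowers_le]
        change A.ρ (zpowersHom G g (Multiplicative.ofAdd 1)) (b i) = _
        simp [χ, hb]
      refine hS ⟨m.toAdd, ?_⟩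
      change Multiplicative.ofAdd (1 : ℤ) ^ m.toAdd = m
      rw [← ofAdd_zsmul, smul_eq_mul, mul_one, ofAdd_toAdd]
    have hBeq : B ≈ SmoothRep.pi fun i => SmoothRep.line (χ i) (smooth_of_discrete _) := by
      refine SmoothRep.equiv_of (A := B)
        (B := SmoothRep.pi fun i => SmoothRep.line (χ i) (smooth_of_discrete _)) b.equivFun
        fun m => b.ext fun i => ?_
      change b.equivFun (A.ρ (zpowersHom G g m) (b i)) =
        (SmoothRep.pi fun i => SmoothRep.line (χ i) (smooth_of_discrete _)).ρ m (b.equivFun (b i))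
      rw [hχ, map_smul]
      funext j
      change ((χ i m : Kˣ) : K) • b.equivFun (b i) j = ((χ j m : Kˣ) : K) * b.equivFun (b i) j
      rw [smul_eq_mul, Module.Basis.equivFun_self]
      split_ifs with h
      · rw [h]
      · rw [mul_zero, mul_zero]
    have hsum : ofRep B = ∑ i, lineClass (χ i) (smooth_of_discrete _) := by
      rw [ofRep_eq_of_equiv hBeq]
      exact (congrArg cls (RepClass.sum_mk _).symm).trans (map_sum cls _ _)
    rw [hsum]
    exact sum_mem fun i _ => AddSubgroup.subset_closure ⟨_, _, rfl⟩
  | h2 x y hx hy => rw [map_add]; exact add_mem hx hy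
  | h3 x hx => rw [map_neg]; exact neg_mem hx

theorem _root_.zpowersHom_ofAdd_one {G : Type*} [Group G] (g : G) : zpowersHom G g (Multiplicative.ofAdd 1) = g := by simp

section Splitting

variable [IsAlgClosed K] [CharZero K] [CompactSpace G] [IsTopologicalGroup G]

/-- The character of `ψ^k x` at `g` is the character of `x` at `g ^ k`. -/
theorem traceHom_adams {k : ℕ} (hk : k ≠ 0) (g : G) (x : RepRing K G) :
    traceHom g (adams k x) = traceHom (g ^ k) x := by
  have key : ∀ y ∈ AddSubgroup.closure
      {y | ∃ χ hχ, y = lineClass (K := K) (G := Multiplicative ℤ) χ hχ},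
      ∀ h : Multiplicative ℤ, traceHom h (adams k y) = traceHom (h ^ k) y := by
    intro y hy h
    induction hy using AddSubgroup.closure_induction with
    | mem y hy =>
      obtain ⟨χ, hχ, rfl⟩ := hy
      have hpow : ∀ m : ℕ, lineClass χ hχ ^ m = lineClass (χ ^ m) (smooth_of_discrete _) := by
        intro m
        induction m with
        | zero =>
          rw [pow_zero, ← lineClass_one]
          exact lineClass_congr (pow_zero χ).symm
        | succ m ih =>
          rw [pow_succ, ih, ← lineClass_mul]
          exact lineClass_congr (pow_succ χ m).symm
      rw [adams_lineClass hk, hpow, traceHom_lineClass, traceHom_lineClass, map_pow]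
      rfl
    | zero => simp
    | add y z _ _ h1 h2 => rw [map_add, map_add, map_add, h1, h2]
    | neg y _ h1 => rw [map_neg, map_neg, map_neg, h1]
  have h := key _ (res_zpowersHom_mem_closure g x) (Multiplicative.ofAdd 1)
  rwa [← res_adams, traceHom_res, traceHom_res, map_pow, zpowersHom_ofAdd_one] at h

theorem augmentation_adams {k : ℕ} (hk : k ≠ 0) (x : RepRing K G) :
    augmentation (adams k x) = augmentation x := by
  have e : ∀ y : RepRing K G, traceHom 1 y = (augmentation y : K) := by
    intro y
    induction y using ofRep_induction with
    | h1 A => rw [traceHom_ofRep, map_one, augmentation_ofRep, LinearMap.trace_one, Int.cast_natCast]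
    | h2 x y hx hy => rw [map_add, map_add, hx, hy, Int.cast_add]
    | h3 x hx => rw [map_neg, map_neg, hx, Int.cast_neg]
  have h := traceHom_adams hk (1 : G) x
  rw [one_pow, e, e] at h
  exact_mod_cast h

/-- The Adams operator `ψ^k` raises determinants to the `k`-th power. -/
theorem det_adams {k : ℕ} (hk : k ≠ 0) (g : G) (x : RepRing K G) :
    det g (adams k x) = k • det g x := by
  have key : ∀ y ∈ AddSubgroup.closure
      {y | ∃ χ hχ, y = lineClass (K := K) (G := Multiplicative ℤ) χ hχ},
      ∀ h : Multiplicative ℤ, det h (adams k y) = k • det h y := by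
    intro y hy h
    induction hy using AddSubgroup.closure_induction with
    | mem y hy =>
      obtain ⟨χ, hχ, rfl⟩ := hy
      have hpow : ∀ m : ℕ, det h (lineClass χ hχ ^ m) = m • det h (lineClass χ hχ) := by
        intro m
        induction m with
        | zero => rw [pow_zero, det_one, zero_smul]
        | succ m ih =>
          rw [pow_succ, det_mul, ih, map_pow, augmentation_lineClass, one_pow, one_smul, one_smul,
            succ_nsmul]
      rw [adams_lineClass hk, hpow]
    | zero => simp
    | add y z _ _ h1 h2 => rw [map_add, map_add, map_add, h1, h2, nsmul_add]
    | neg y _ h1 => rw [map_neg, map_neg, map_neg, h1, neg_nsmul]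
  have h := key _ (res_zpowersHom_mem_closure g x) (Multiplicative.ofAdd 1)
  rwa [← res_adams, det_res, det_res, zpowersHom_ofAdd_one] at h

/-- Modulo the virtual representations of dimension zero on which `g` has determinant one, the
operation `γ^n` on the augmentation ideal is trivial except that `γ^0 = 1` and `γ^1 = id`. -/
theorem gammaOp_sub_mem_detIdeal (g : G) (n : ℕ) {x : RepRing K G} (hx : augmentation x = 0) :
    gammaOp n x - coeff n (1 + C x * X) ∈ detIdeal K g := by
  have h := map_gammaSeries_of_mem_closure (Multiplicative.ofAdd (1 : ℤ))
    (res_zpowersHom_mem_closure g x)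
  rw [augmentation_res, hx, Int.cast_zero, sub_zero] at h
  have h2 := congrArg (coeff n) h
  rw [PowerSeries.coeff_map] at h2
  have h3 : coeff n (1 + C (Ideal.Quotient.mk (detIdeal K (Multiplicative.ofAdd (1 : ℤ)))
      (res (zpowersHom G g) (zpowersHom_continuous g) x)) * X) =
      Ideal.Quotient.mk _ (res (zpowersHom G g) (zpowersHom_continuous g)
        (coeff n (1 + C x * X))) := by
    rw [← PowerSeries.coeff_map, ← PowerSeries.coeff_map]
    simp
  rw [h3, Ideal.Quotient.eq] at h2
  change gammaOp n _ - _ ∈ _ at h2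
  rw [← res_gammaOp, ← map_sub] at h2
  obtain ⟨h4, h5⟩ := h2
  rw [augmentation_res] at h4
  rw [det_res, zpowersHom_ofAdd_one] at h5
  exact ⟨h4, h5⟩

/-- Elements of `R_{G,2}` have dimension zero and trivial determinant. -/
theorem gammaFil_two_le (g : G) :
    gammaFil K G 2 ≤ (detIdeal K g).toAddSubgroup := by
  refine (AddSubgroup.closure_le _).2 ?_
  rintro _ ⟨l, hl, hn, rfl⟩
  -- monomials of weight one have dimension zero, which is needed when a factor `γ^1` is split off
  have key : (1 ≤ (l.map Prod.fst).sum →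
      augmentation (l.map fun q => gammaOp q.1 q.2).prod = 0) ∧
      (2 ≤ (l.map Prod.fst).sum → (l.map fun q => gammaOp q.1 q.2).prod ∈ detIdeal K g) := by
    clear hn
    induction l with
    | nil => simp
    | cons q l ih =>
      obtain ⟨ih1, ih2⟩ := ih fun r hr => hl r (List.mem_cons_of_mem _ hr)
      obtain ⟨n, x⟩ := q
      have hx : augmentation x = 0 := hl (n, x) List.mem_cons_self
      have h := gammaOp_sub_mem_detIdeal g n hx
      simp only [List.map_cons, List.prod_cons, List.sum_cons]
      set P := (l.map fun q => gammaOp q.1 q.2).prod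
      match n with
      | 0 =>
        simp at h
        have e : gammaOp 0 x * P = (gammaOp 0 x - 1) * P + P := by ring
        rw [e, zero_add]
        refine ⟨fun hs => ?_, fun hs => add_mem (Ideal.mul_mem_right _ _ h) (ih2 hs)⟩
        rw [map_add, map_mul, ih1 hs, mul_zero, add_zero]
      | 1 =>
        simp [coeff_one] at h
        have h1 : augmentation (gammaOp 1 x) = 0 := by
          have h2 := h.1
          rwa [map_sub, hx, sub_zero] at h2
        exact ⟨fun _ => by rw [map_mul, h1, zero_mul],
          fun hs => mul_mem_detIdeal g h1 (ih1 (by omega))⟩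
      | n + 2 =>
        simp [coeff_one] at h
        exact ⟨fun _ => by rw [map_mul, h.1, zero_mul], fun _ => Ideal.mul_mem_right _ _ h⟩
  exact key.2 hn

end Splitting

end RepRing

/-! ### The second step of the gamma filtration -/

namespace RepRing

open PowerSeries

variable {K : Type u} [Field K] {G : Type v} [Group G] [TopologicalSpace G]

theorem coeff_zero_lambdaSeries (x : RepRing K G) :
    constantCoeff (lambdaSeries x : (RepRing K G)⟦X⟧) = 1 := by
  induction x using ofRep_induction with
  | h1 A => rw [← coeff_zero_eq_constantCoeff_apply, coeff_lambdaSeries_ofRep, ofRep_ext_zero]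
  | h2 x y hx hy => rw [lambdaSeries_add, Units.val_mul, map_mul, hx, hy, one_mul]
  | h3 x hx =>
    have h := lambdaSeries_add x (-x)
    rw [add_neg_cancel] at h
    have h0 : lambdaSeries (0 : RepRing K G) = 1 := by rw [lambdaSeries, map_zero, toMul_zero]
    have h1 := congrArg (fun u : (RepRing K G)⟦X⟧ˣ => constantCoeff (u : (RepRing K G)⟦X⟧)) h
    simp only [h0, Units.val_one, map_one, Units.val_mul, map_mul, hx, one_mul] at h1
    exact h1.symm

theorem coeff_one_lambdaSeries (x : RepRing K G) :
    coeff 1 (lambdaSeries x : (RepRing K G)⟦X⟧) = x := by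
  have h : ∀ x y : RepRing K G, coeff 1 (lambdaSeries (x + y) : (RepRing K G)⟦X⟧) =
      coeff 1 (lambdaSeries x : (RepRing K G)⟦X⟧) + coeff 1 (lambdaSeries y : (RepRing K G)⟦X⟧) := by
    intro x y
    rw [lambdaSeries_add, Units.val_mul, coeff_one_mul, coeff_zero_lambdaSeries,
      coeff_zero_lambdaSeries, mul_one, mul_one]
  let f : RepRing K G →+ RepRing K G := AddMonoidHom.mk' (fun x => coeff 1 (lambdaSeries x : (RepRing K G)⟦X⟧)) h
  have hf : f = AddMonoidHom.id _ := hom_ext_ofRep fun A => by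
    change coeff 1 (lambdaSeries (ofRep A) : (RepRing K G)⟦X⟧) = ofRep A
    rw [coeff_lambdaSeries_ofRep, ofRep_ext_one]
  exact DFunLike.congr_fun hf x

/-- Substitution of `t / (1 - t)`, expanded to first order. -/
theorem subst_X_mul_geom_eq {R : Type*} [CommRing R] (f : R⟦X⟧) :
    f.subst (X * PowerSeries.mk (fun _ => 1) : R⟦X⟧) = X * (PowerSeries.mk (fun _ => 1) *
      (PowerSeries.mk fun n => coeff (n + 1) f).subst (X * PowerSeries.mk (fun _ => 1) : R⟦X⟧)) +
        C (constantCoeff f) := by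
  conv_lhs => rw [f.eq_X_mul_shift_add_const]
  rw [subst_add (hasSubst_X_mul_geom _), subst_mul (hasSubst_X_mul_geom _),
    subst_X (hasSubst_X_mul_geom _), mul_assoc]
  congr 1
  exact subst_C _

theorem gammaOp_zero (x : RepRing K G) : gammaOp 0 x = 1 := by
  rw [gammaOp, gammaSeries, subst_X_mul_geom_eq, coeff_zero_lambdaSeries]
  simp

theorem gammaOp_one (x : RepRing K G) : gammaOp 1 x = x := by
  have h : ∀ f : (RepRing K G)⟦X⟧, constantCoeff
      (f.subst (X * PowerSeries.mk (fun _ => 1) : (RepRing K G)⟦X⟧)) = constantCoeff f := by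
    intro f
    rw [subst_X_mul_geom_eq]
    simp
  rw [gammaOp, gammaSeries, subst_X_mul_geom_eq, map_add, ← zero_add 1,
    coeff_succ_X_mul, coeff_zero_eq_constantCoeff_apply, map_mul, h, constantCoeff_mk, ← coeff_zero_eq_constantCoeff_apply (PowerSeries.mk _),
    coeff_mk, zero_add, zero_add, coeff_one_lambdaSeries]
  simp

theorem gammaOp_mem_gammaFil {n : ℕ} {x : RepRing K G} (hx : augmentation x = 0) :
    gammaOp n x ∈ gammaFil K G n :=
  AddSubgroup.subset_closure ⟨[(n, x)], fun q hq => List.mem_singleton.1 hq ▸ hx, by simp, by simp⟩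

theorem gammaFil_antitone : Antitone (gammaFil K G) := fun _ _ hmn =>
  AddSubgroup.closure_mono fun _ ⟨l, hl, hn, h⟩ => ⟨l, hl, hmn.trans hn, h⟩

theorem mul_mem_gammaFil_two {x y : RepRing K G} (hx : augmentation x = 0)
    (hy : augmentation y = 0) : x * y ∈ gammaFil K G 2 := by
  refine AddSubgroup.subset_closure ⟨[(1, x), (1, y)], ?_, by simp, by simp [gammaOp_one]⟩
  intro q hq
  simp only [List.mem_cons, List.not_mem_nil, or_false] at hq
  obtain rfl | rfl := hq
  · exact hx
  · exact hy

/-- The top exterior power of a representation `V` of dimension `n` is the sum of all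
`γ^k(V - n)`: the series `γ_t(V - n) = ∑ λ^i(V) t^i (1 - t)^(n - i)` is a polynomial, which is
evaluated at `t = 1`. -/
theorem sum_gammaOp_eq (A : SmoothRep K G) (m : ℕ) (hm : Module.finrank K A.V < m) :
    ∑ k ∈ Finset.range m, gammaOp k (ofRep A - (Module.finrank K A.V : RepRing K G)) =
      ofRep (A.ext (Module.finrank K A.V)) := by
  set n := Module.finrank K A.V with hn
  let P : Polynomial (RepRing K G) := ∑ i ∈ Finset.range (n + 1),
    Polynomial.C (ofRep (A.ext i)) * (Polynomial.X ^ i * (1 - Polynomial.X) ^ (n - i))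
  have h1 : (lambdaSeries (ofRep A) : (RepRing K G)⟦X⟧) =
      ∑ i ∈ Finset.range (n + 1), C (ofRep (A.ext i)) * X ^ i := by
    ext k
    rw [coeff_lambdaSeries_ofRep, map_sum]
    simp only [coeff_C_mul, coeff_X_pow, mul_ite, mul_one, mul_zero, Finset.sum_ite_eq,
      Finset.mem_range]
    split_ifs with h
    · rfl
    · exact ofRep_ext_eq_zero A (by omega)
  have hgeom : (PowerSeries.mk fun _ => 1 : (RepRing K G)⟦X⟧) * (1 - X) = 1 :=
    mk_one_mul_one_sub_eq_one _
  have h2 : gammaSeries (ofRep A - (n : RepRing K G)) = (P : (RepRing K G)⟦X⟧) := by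
    rw [gammaSeries_sub_natCast, gammaSeries, h1, ← coe_substAlgHom (hasSubst_X_mul_geom _),
      map_sum, Finset.sum_mul]
    change _ = Polynomial.coeToPowerSeries.ringHom P
    rw [map_sum]
    refine Finset.sum_congr rfl fun i hi => ?_
    have hi' : i ≤ n := Nat.lt_succ_iff.1 (Finset.mem_range.1 hi)
    have hC : substAlgHom (hasSubst_X_mul_geom (RepRing K G)) (C (ofRep (A.ext i))) =
        C (ofRep (A.ext i)) := by
      rw [coe_substAlgHom]
      exact subst_C _
    rw [map_mul, map_pow, substAlgHom_X, hC]
    have hsplit : (1 - X : (RepRing K G)⟦X⟧) ^ n = (1 - X) ^ i * (1 - X) ^ (n - i) := by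
      rw [← pow_add, Nat.add_sub_cancel' hi']
    have hone : ((PowerSeries.mk fun _ => 1 : (RepRing K G)⟦X⟧)) ^ i * (1 - X) ^ i = 1 := by
      rw [← mul_pow, hgeom, one_pow]
    simp only [map_mul, map_pow, map_sub, map_one, Polynomial.coeToPowerSeries.ringHom_apply,
      Polynomial.coe_C, Polynomial.coe_X]
    rw [hsplit, mul_pow]
    linear_combination C (ofRep (A.ext i)) * X ^ i * (1 - X) ^ (n - i) * hone
  have hdeg : P.natDegree < m := by
    refine lt_of_le_of_lt (Polynomial.natDegree_sum_le_of_forall_le _ _ fun i hi => ?_) hm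
    have hi' : i ≤ n := Nat.lt_succ_iff.1 (Finset.mem_range.1 hi)
    refine (Polynomial.natDegree_C_mul_le _ _).trans (Polynomial.natDegree_mul_le.trans ?_)
    have e1 : (Polynomial.X ^ i : Polynomial (RepRing K G)).natDegree ≤ i :=
      Polynomial.natDegree_X_pow_le i
    have e2 : ((1 - Polynomial.X : Polynomial (RepRing K G)) ^ (n - i)).natDegree ≤ n - i := by
      refine (Polynomial.natDegree_pow_le).trans ?_
      have e3 : (1 - Polynomial.X : Polynomial (RepRing K G)).natDegree ≤ 1 :=
        (Polynomial.natDegree_sub_le _ _).trans (by simp [Polynomial.natDegree_X_le])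
      calc _ ≤ (n - i) * 1 := Nat.mul_le_mul_left _ e3
        _ = _ := mul_one _
    omega
  have h3 := P.eval_eq_sum_range' hdeg 1
  have h4 : P.eval 1 = ofRep (A.ext n) := by
    -- only the term `i = n` has no factor `1 - X`
    rw [Polynomial.eval_finsetSum, Finset.sum_eq_single n]
    · simp
    · intro i hi hin
      have : n - i ≠ 0 := by
        have := Finset.mem_range.1 hi
        omega
      simp [this]
    · simp
  rw [← h4, h3]
  refine Finset.sum_congr rfl fun k _ => ?_
  rw [gammaOp, h2, Polynomial.coeff_coe, one_pow, mul_one]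

/-- Modulo `R_{G,2}`, only `γ^0 = 1` and `γ^1 = id` contribute to the expression of the top exterior
power of `V` through the `γ^k(V - dim V)`. -/
theorem ext_top_sub_mem_gammaFil (A : SmoothRep K G) :
    ofRep (A.ext (Module.finrank K A.V)) - 1 - (ofRep A - (Module.finrank K A.V : RepRing K G)) ∈
      gammaFil K G 2 := by
  have haug : augmentation (ofRep A - (Module.finrank K A.V : RepRing K G)) = 0 := by
    rw [map_sub, augmentation_ofRep, map_natCast, sub_self]
  rw [← sum_gammaOp_eq A (Module.finrank K A.V + 2) (by omega), Finset.sum_range_succ',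
    Finset.sum_range_succ', gammaOp_zero, gammaOp_one]
  have e : ∀ s a : RepRing K G, s + a + 1 - 1 - a = s := fun s a => by ring
  rw [e]
  exact sum_mem fun k _ => gammaFil_antitone (by omega : 2 ≤ k + 1 + 1) (gammaOp_mem_gammaFil haug)

/-- Modulo `R_{G,2}`, the map `L ↦ L - 1` on one-dimensional representations turns tensor products
into sums. -/
theorem lineClass_mul_sub_mem {χ ψ : G →* Kˣ} (hχ : ∃ U : OpenSubgroup G, ∀ g ∈ U, χ g = 1)
    (hψ : ∃ U : OpenSubgroup G, ∀ g ∈ U, ψ g = 1) :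
    lineClass (χ * ψ) (smooth_mul hχ hψ) - 1 - (lineClass χ hχ - 1) - (lineClass ψ hψ - 1) ∈
      gammaFil K G 2 := by
  have e : lineClass (χ * ψ) (smooth_mul hχ hψ) - 1 - (lineClass χ hχ - 1) - (lineClass ψ hψ - 1) =
      (lineClass χ hχ - 1) * (lineClass ψ hψ - 1) := by
    rw [lineClass_mul hχ hψ]
    ring
  have h : ∀ (χ : G →* Kˣ) (hχ : ∃ U : OpenSubgroup G, ∀ g ∈ U, χ g = 1),
      augmentation (lineClass χ hχ - 1) = 0 := fun χ hχ => by
    rw [map_sub, augmentation_lineClass, map_one, sub_self]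
  rw [e]
  exact mul_mem_gammaFil_two (h _ hχ) (h _ hψ)

section Compact

variable [IsAlgClosed K] [CharZero K] [CompactSpace G] [IsTopologicalGroup G]

/-- Modulo the second step of the gamma filtration, a virtual representation is determined by its
dimension and its determinant. -/
theorem exists_lineClass_sub_mem (x : RepRing K G) :
    ∃ (χ : G →* Kˣ) (hχ : ∃ U : OpenSubgroup G, ∀ g ∈ U, χ g = 1),
      (∀ g, det g x = Additive.ofMul (χ g)) ∧
      x - (augmentation x : RepRing K G) - (lineClass χ hχ - 1) ∈ gammaFil K G 2 := by
  induction x using ofRep_induction with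
  | h1 A =>
    set T := A.ext (Module.finrank K A.V) with hT
    have h1 : Module.finrank K T.V = 1 := by rw [finrank_ext, Nat.choose_self]
    have h2 := ext_top_sub_mem_gammaFil A
    rw [← hT, ofRep_eq_lineClass T h1] at h2
    refine ⟨T.detChar, T.smooth_detChar, fun g => ?_, ?_⟩
    -- the determinant kills `R_{G,2}`, so the congruence identifies the character
    · have h3 := (gammaFil_two_le g h2).2
      have h4 : ∀ n : ℕ, det g (n : RepRing K G) = 0 := fun n => by
        rw [← nsmul_one, map_nsmul, det_one, nsmul_zero]
      rw [map_sub, map_sub, map_sub, det_lineClass, det_one, h4, sub_zero, sub_zero, sub_eq_zero]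
        at h3
      exact h3.symm
    · rw [augmentation_ofRep, Int.cast_natCast]
      have h3 := neg_mem h2
      rwa [neg_sub] at h3
  | h2 x y hx hy =>
    obtain ⟨χ, hχ, h1, h2⟩ := hx
    obtain ⟨ψ, hψ, h3, h4⟩ := hy
    refine ⟨χ * ψ, smooth_mul hχ hψ, fun g => ?_, ?_⟩
    · rw [map_add, h1, h3]
      rfl
    · have h5 := sub_mem (add_mem h2 h4) (lineClass_mul_sub_mem hχ hψ)
      convert h5 using 1
      rw [map_add, Int.cast_add]
      ring
  | h3 x hx =>
    obtain ⟨χ, hχ, h1, h2⟩ := hx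
    refine ⟨χ⁻¹, smooth_inv hχ, fun g => ?_, ?_⟩
    · rw [map_neg, h1]
      rfl
    · have h5 := sub_mem (neg_mem h2) (neg_mem (lineClass_mul_sub_mem hχ (smooth_inv hχ)))
      have h6 : lineClass (χ * χ⁻¹) (smooth_mul hχ (smooth_inv hχ)) = (1 : RepRing K G) := by
        rw [← lineClass_one]
        exact lineClass_congr (mul_inv_cancel χ)
      rw [h6] at h5
      convert h5 using 1
      rw [map_neg, Int.cast_neg]
      ring

/-- Conversely to `gammaFil_two_le`, dimension zero and trivial determinant characterize the elements
of `R_{G,2}`. -/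
theorem mem_gammaFil_two {x : RepRing K G} (hx : augmentation x = 0) (hd : ∀ g : G, det g x = 0) :
    x ∈ gammaFil K G 2 := by
  obtain ⟨χ, hχ, h1, h2⟩ := exists_lineClass_sub_mem x
  have h3 : χ = 1 := MonoidHom.ext fun g => by
    have h := h1 g
    rw [hd g] at h
    exact (congrArg Additive.toMul h).symm
  have h4 : lineClass χ hχ = 1 := by
    rw [← lineClass_one]
    exact lineClass_congr h3
  rwa [h4, hx, Int.cast_zero, sub_zero, sub_self, sub_zero] at h2

theorem disjoint_zmultiples_gammaFil :
    Disjoint (AddSubgroup.zmultiples (1 : RepRing K G)) (gammaFil K G 2) := by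
  rw [AddSubgroup.disjoint_def]
  rintro _ ⟨n, rfl⟩ h
  have h1 : augmentation (n • (1 : RepRing K G)) = 0 := (gammaFil_two_le 1 h).1
  rw [map_zsmul, map_one, smul_eq_mul, mul_one] at h1
  simp [h1]

/-- The element `k x - ψ^k x` has dimension `(k - 1) dim x` and trivial determinant, since `ψ^k`
preserves dimensions and raises determinants to the `k`-th power. -/
theorem range_nsmul_sub_adams_le {k : ℕ} (hk : k ≠ 0) :
    (k • AddMonoidHom.id (RepRing K G) - adams k).range ≤
      AddSubgroup.zmultiples (((k : ℤ) - 1) • (1 : RepRing K G)) ⊔ gammaFil K G 2 := by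
  rintro _ ⟨x, rfl⟩
  have hz : augmentation x • ((k : ℤ) - 1) • (1 : RepRing K G) ∈
      AddSubgroup.zmultiples (((k : ℤ) - 1) • (1 : RepRing K G)) := ⟨_, rfl⟩
  have hy : k • x - adams k x - augmentation x • ((k : ℤ) - 1) • (1 : RepRing K G) ∈
      gammaFil K G 2 := by
    refine mem_gammaFil_two ?_ fun g => ?_
    · rw [map_sub, map_sub, map_nsmul, augmentation_adams hk, map_zsmul, map_zsmul, map_one]
      simp only [nsmul_eq_mul, smul_eq_mul]
      ring
    · rw [map_sub, map_sub, map_nsmul, det_adams hk, map_zsmul, map_zsmul, det_one, sub_self,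
        zsmul_zero, zsmul_zero, sub_zero]
  have h := AddSubgroup.add_mem_sup hz hy
  rwa [add_sub_cancel] at h

end Compact

/-! ### Determinants and field automorphisms -/

theorem det_mul_left (g h : G) (x : RepRing K G) : det (g * h) x = det g x + det h x := by
  induction x using ofRep_induction with
  | h1 A => rw [det_ofRep, det_ofRep, det_ofRep, map_mul, ofMul_mul]
  | h2 x y hx hy => rw [map_add, map_add, map_add, hx, hy]; abel
  | h3 x hx => rw [map_neg, map_neg, map_neg, hx]; abel

theorem conj_ofRep (σ : K ≃+* K) (A : SmoothRep K G) : conj σ (ofRep A) = ofRep (A.conj σ) :=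
  lift_cls _ _

/-- A basis of `M`, as a basis of the twisted space. -/
def conjBasis (σ : K ≃+* K) {M : Type u} [AddCommGroup M] [Module K M] {ι : Type*} [Fintype ι]
    (b : Module.Basis ι K M) : Module.Basis ι K (Conj σ M) :=
  .ofEquivFun
    { toFun := fun x i => σ (b.equivFun (show M from x) i)
      invFun := fun v => (b.equivFun.symm fun i => σ.symm (v i) : M)
      map_add' := fun x y => funext fun i => by
        change σ (b.equivFun ((show M from x) + (show M from y)) i) = _
        rw [map_add, Pi.add_apply, map_add]
        rfl
      map_smul' := fun c x => funext fun i => by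
        change σ (b.equivFun (σ.symm c • (show M from x)) i) = _
        rw [map_smul, Pi.smul_apply, smul_eq_mul, map_mul, RingEquiv.apply_symm_apply]
        rfl
      left_inv := fun x => by
        change b.equivFun.symm (fun i => σ.symm (σ (b.equivFun (show M from x) i))) = x
        simp only [RingEquiv.symm_apply_apply]
        exact b.equivFun.symm_apply_apply _
      right_inv := fun v => funext fun i => by
        change σ (b.equivFun (b.equivFun.symm fun i => σ.symm (v i)) i) = v i
        rw [LinearEquiv.apply_symm_apply, RingEquiv.apply_symm_apply] }

theorem conjBasis_equivFun (σ : K ≃+* K) {M : Type u} [AddCommGroup M] [Module K M] {ι : Type*}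
    [Fintype ι] (b : Module.Basis ι K M) (x : M) (i : ι) :
    (conjBasis σ b).equivFun (show Conj σ M from x) i = σ (b.equivFun x i) := by
  rw [conjBasis, Module.Basis.equivFun_ofEquivFun]
  rfl

theorem det_conjMap (σ : K ≃+* K) {M : Type u} [AddCommGroup M] [Module K M] [Module.Finite K M]
    (f : M →ₗ[K] M) : LinearMap.det (Conj.map σ f) = σ (LinearMap.det f) := by
  let b := Module.finBasis K M
  have hb : ∀ j, conjBasis σ b j = (show Conj σ M from b j) := by
    intro j
    refine (conjBasis σ b).equivFun.injective (funext fun i => ?_)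
    rw [conjBasis_equivFun, Module.Basis.equivFun_self, Module.Basis.equivFun_self]
    split_ifs <;> simp
  have h : LinearMap.toMatrix (conjBasis σ b) (conjBasis σ b) (Conj.map σ f) =
      (LinearMap.toMatrix b b f).map σ := by
    ext i j
    rw [LinearMap.toMatrix_apply, Matrix.map_apply, LinearMap.toMatrix_apply, hb]
    exact conjBasis_equivFun σ b (f (b j)) i
  rw [← LinearMap.det_toMatrix (conjBasis σ b), h, ← LinearMap.det_toMatrix b]
  exact (RingHom.map_det (σ : K →+* K) _).symm

/-- Conjugation of representations acts on determinants through the values. -/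
theorem det_conj (σ : K ≃+* K) (g : G) (x : RepRing K G) :
    (((det g (conj σ x)).toMul : Kˣ) : K) = σ ((det g x).toMul : Kˣ) := by
  have h : det g (conj σ x) =
      MonoidHom.toAdditive (Units.map (σ : K →* K)) (det g x) := by
    induction x using ofRep_induction with
    | h1 A =>
      rw [conj_ofRep, det_ofRep, det_ofRep]
      exact congrArg Additive.ofMul (Units.ext (det_conjMap σ (A.ρ g)))
    | h2 x y hx hy => rw [map_add, map_add, map_add, map_add, hx, hy]
    | h3 x hx => rw [map_neg, map_neg, map_neg, map_neg, hx]
  rw [h]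
  rfl

end RepRing

/-! ### Duality between a pro-`p` group and its characters -/

section Duality

open RepRing

variable {p : ℕ} [Fact p.Prime] {G : Type v} [Group G] [TopologicalSpace G]

/-- The determinant of an element of a pro-`p` group is a root of unity of `p`-power order. -/
theorem IsProPGroup.det_mem_muPInf (hG : IsProPGroup p G) (g : G) (x : RepRing (QpBar p) G) :
    (det g x).toMul ∈ muPInf p := by
  have := hG.compactSpace
  have := hG.totallyDisconnectedSpace
  have := hG.isTopologicalGroup
  induction x using ofRep_induction with
  | h1 A =>
    obtain ⟨U, hU⟩ := A.smooth
    obtain ⟨N, hN⟩ := ProfiniteGrp.exist_openNormalSubgroup_sub_open_nhds_of_one U.isOpen (one_mem U)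
    obtain ⟨n, hn⟩ := hG.isPGroup_quotient p (N : Subgroup G) N.isOpen (g : G ⧸ (N : Subgroup G))
    refine ⟨n, ?_⟩
    rw [det_ofRep, toMul_ofMul, ← map_pow]
    have hg : g ^ p ^ n ∈ (N : Subgroup G) := (QuotientGroup.eq_one_iff _).1 hn
    refine Units.ext ?_
    change LinearMap.det (A.ρ (g ^ p ^ n)) = 1
    rw [hU _ (hN hg), map_one]
  | h2 x y hx hy =>
    rw [map_add, toMul_add]
    exact mul_mem hx hy
  | h3 x hx =>
    rw [map_neg, toMul_neg]
    exact inv_mem hx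

variable (p) in
/-- Elements of `G` outside the closed commutator subgroup are detected by characters which are
trivial on an open subgroup. -/
theorem IsProPGroup.mem_commutator_of_forall_char (hG : IsProPGroup p G)
    (hc : IsClosed (commutator G : Set G)) {g : G}
    (hg : ∀ χ : G →* (QpBar p)ˣ, (∃ U : OpenSubgroup G, ∀ g ∈ U, χ g = 1) → χ g = 1) :
    g ∈ commutator G := by
  have := hG.compactSpace
  have := hG.totallyDisconnectedSpace
  have := hG.isTopologicalGroup
  by_contra hgc
  have hW : IsOpen ((fun h => g * h) ⁻¹' (commutator G : Set G)ᶜ) :=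
    hc.isOpen_compl.preimage (continuous_const_mul g)
  obtain ⟨N, hN⟩ := ProfiniteGrp.exist_openNormalSubgroup_sub_open_nhds_of_one hW
    (by simpa using hgc)
  have : Finite (G ⧸ (N : Subgroup G)) := hG.finite_quotient p _ N.isOpen
  let π : G →* Abelianization (G ⧸ (N : Subgroup G)) :=
    Abelianization.of.comp (QuotientGroup.mk' (N : Subgroup G))
  have : Finite (Abelianization (G ⧸ (N : Subgroup G))) :=
    Finite.of_surjective _ (QuotientGroup.mk'_surjective _)
  have hπ : π g ≠ 1 := by
    intro h
    have h1 : QuotientGroup.mk' (N : Subgroup G) g ∈ commutator (G ⧸ (N : Subgroup G)) :=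
      (QuotientGroup.eq_one_iff _).1 h
    have h2 : commutator (G ⧸ (N : Subgroup G)) =
        (commutator G).map (QuotientGroup.mk' (N : Subgroup G)) := by
      rw [commutator_def, commutator_def, Subgroup.map_commutator,
        Subgroup.map_top_of_surjective _ (QuotientGroup.mk'_surjective _)]
    rw [h2] at h1
    obtain ⟨c, hcc, hcg⟩ := h1
    have h3 : g⁻¹ * c ∈ (N : Subgroup G) := QuotientGroup.eq.1 hcg.symm
    have h4 := hN h3
    simp only [Set.mem_preimage, mul_inv_cancel_left, Set.mem_compl_iff] at h4
    exact h4 hcc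
  obtain ⟨φ, hφ⟩ := CommGroup.exists_apply_ne_one_of_hasEnoughRootsOfUnity
    (Abelianization (G ⧸ (N : Subgroup G))) (QpBar p) hπ
  refine hφ (hg (φ.comp π) ⟨N.toOpenSubgroup, fun h hh => ?_⟩)
  have : QuotientGroup.mk' (N : Subgroup G) h = 1 := (QuotientGroup.eq_one_iff _).2 hh
  rw [MonoidHom.comp_apply, MonoidHom.comp_apply, this, map_one, map_one]

/-- Every homomorphism which kills `ℤ · 1` and `R_{G,2}` is the determinant at an element of `G`.
It is determined by the homomorphism it induces on the group of characters which are trivial on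
an open subgroup. By duality for finite abelian groups there are elements which work for all
characters trivial on a given open normal subgroup; they form a closed set, and these sets have a
common element by compactness. -/
theorem IsProPGroup.exists_eval (hG : IsProPGroup p G)
    (F : RepRing (QpBar p) G →+ Additive (QpBar p)ˣ) (hF1 : F 1 = 0)
    (hF2 : ∀ x ∈ gammaFil (QpBar p) G 2, F x = 0) : ∃ g : G, ∀ x, F x = det g x := by
  have := hG.compactSpace
  have := hG.totallyDisconnectedSpace
  have := hG.isTopologicalGroup
  have hmul : ∀ {χ ψ : G →* (QpBar p)ˣ} (hχ : ∃ U : OpenSubgroup G, ∀ g ∈ U, χ g = 1)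
      (hψ : ∃ U : OpenSubgroup G, ∀ g ∈ U, ψ g = 1),
      F (lineClass (χ * ψ) (smooth_mul hχ hψ)) = F (lineClass χ hχ) + F (lineClass ψ hψ) := by
    intro χ ψ hχ hψ
    have h := hF2 _ (lineClass_mul_sub_mem hχ hψ)
    rw [map_sub, map_sub, map_sub, map_sub, map_sub, hF1, sub_zero, sub_zero, sub_zero, sub_sub,
      sub_eq_zero] at h
    exact h
  let S : OpenNormalSubgroup G → Set G := fun N =>
    {g | ∀ (χ : G →* (QpBar p)ˣ) (hχ : ∀ h ∈ N.toOpenSubgroup, χ h = 1),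
      F (lineClass χ ⟨N.toOpenSubgroup, hχ⟩) = Additive.ofMul (χ g)}
  have hne : ∀ N, (S N).Nonempty := by
    intro N
    have : Finite (G ⧸ (N : Subgroup G)) := hG.finite_quotient p _ N.isOpen
    have : Finite (Abelianization (G ⧸ (N : Subgroup G))) :=
      Finite.of_surjective _ (QuotientGroup.mk'_surjective _)
    let π : G →* Abelianization (G ⧸ (N : Subgroup G)) :=
      Abelianization.of.comp (QuotientGroup.mk' (N : Subgroup G))
    have hπ : Function.Surjective π :=
      (QuotientGroup.mk'_surjective _).comp (QuotientGroup.mk'_surjective _)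
    have hsm : ∀ φ : Abelianization (G ⧸ (N : Subgroup G)) →* (QpBar p)ˣ,
        ∀ h ∈ N.toOpenSubgroup, φ.comp π h = 1 := by
      intro φ h hh
      have : QuotientGroup.mk' (N : Subgroup G) h = 1 := (QuotientGroup.eq_one_iff _).2 hh
      rw [MonoidHom.comp_apply, MonoidHom.comp_apply, this, map_one, map_one]
    let η : (Abelianization (G ⧸ (N : Subgroup G)) →* (QpBar p)ˣ) →* (QpBar p)ˣ :=
      MonoidHom.mk' (fun φ => (F (lineClass (φ.comp π) ⟨N.toOpenSubgroup, hsm φ⟩)).toMul)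
        fun φ ψ => congrArg Additive.toMul
          (hmul ⟨N.toOpenSubgroup, hsm φ⟩ ⟨N.toOpenSubgroup, hsm ψ⟩)
    obtain ⟨g, hg⟩ := hπ (CommGroup.monoidHomMonoidHomEquiv _ (QpBar p) η)
    -- every character trivial on `N` factors through the finite abelian quotient
    refine ⟨g, fun χ hχ => ?_⟩
    let χ' : G ⧸ (N : Subgroup G) →* (QpBar p)ˣ := QuotientGroup.lift _ χ fun h hh => hχ h hh
    let φ := Abelianization.lift χ'
    have hφ : φ.comp π = χ := MonoidHom.ext fun h => rfl
    have h1 := CommGroup.apply_monoidHomMonoidHomEquiv (QpBar p) φ η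
    rw [← hg] at h1
    have h2 : φ (π g) = χ g := DFunLike.congr_fun hφ g
    rw [h2] at h1
    rw [h1]
    exact congrArg F (lineClass_congr hφ.symm)
  have hdir : ∀ N M, N ≤ M → S N ⊆ S M := fun N M hNM g hg χ hχ =>
    hg χ fun h hh => hχ h (hNM hh)
  have hclosed : ∀ N, IsClosed (S N) := by
    intro N
    have hcoset : ∀ g h : G, h ∈ (N : Subgroup G) → (g * h ∈ S N ↔ g ∈ S N) := by
      intro g h hh
      have : ∀ χ : G →* (QpBar p)ˣ, (∀ h ∈ N.toOpenSubgroup, χ h = 1) → χ (g * h) = χ g :=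
        fun χ hχ => by rw [map_mul, hχ h hh, mul_one]
      exact forall_congr' fun χ => forall_congr' fun hχ => by rw [this χ hχ]
    rw [← isOpen_compl_iff, isOpen_iff_mem_nhds]
    intro g hg
    have h1 : (fun h => g⁻¹ * h) ⁻¹' ((N : Subgroup G) : Set G) ∈ nhds g :=
      (N.isOpen.preimage (continuous_const_mul g⁻¹)).mem_nhds (by simp)
    filter_upwards [h1] with h hh hS
    refine hg ((hcoset g (g⁻¹ * h) hh).1 ?_)
    rwa [mul_inv_cancel_left]
  have hinter : (⋂ N, S N).Nonempty := by
    have : Nonempty (OpenNormalSubgroup G) :=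
      ⟨(ProfiniteGrp.exist_openNormalSubgroup_sub_open_nhds_of_one isOpen_univ
        (Set.mem_univ (1 : G))).choose⟩
    refine IsCompact.nonempty_iInter_of_directed_nonempty_isCompact_isClosed S ?_ hne
      (fun N => (hclosed N).isCompact) hclosed
    intro N M
    exact ⟨N ⊓ M, hdir _ _ inf_le_left, hdir _ _ inf_le_right⟩
  obtain ⟨g, hg⟩ := hinter
  refine ⟨g, fun x => ?_⟩
  obtain ⟨χ, ⟨U, hU⟩, h1, h2⟩ := exists_lineClass_sub_mem x
  obtain ⟨N, hN⟩ := ProfiniteGrp.exist_openNormalSubgroup_sub_open_nhds_of_one U.isOpen (one_mem U)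
  have h3 := Set.mem_iInter.1 hg N χ fun h hh => hU h (hN hh)
  have h4 := hF2 _ h2
  have h5 : F (augmentation x : RepRing (QpBar p) G) = 0 := by
    rw [← zsmul_one, map_zsmul, hF1, zsmul_zero]
  rw [map_sub, map_sub, map_sub, h5, hF1, sub_zero, sub_zero, sub_eq_zero] at h4
  rw [h4, h1]
  exact h3

end Duality

/-! ### The determinant isomorphisms -/

section DetHoms

open RepRing

variable {p : ℕ} [Fact p.Prime] {G : Type v} [Group G] [TopologicalSpace G]

/-- The determinant at an element of a pro-`p` group, with values in the `p`-power roots of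
unity. -/
def detMu (hG : IsProPGroup p G) (g : G) : RepRing (QpBar p) G →+ Additive (muPInf p) :=
  AddMonoidHom.mk' (fun x => Additive.ofMul ⟨(det g x).toMul, hG.det_mem_muPInf g x⟩)
    fun x y => congrArg Additive.ofMul (Subtype.ext (congrArg Additive.toMul (map_add (det g) x y)))

theorem coe_detMu (hG : IsProPGroup p G) (g : G) (x : RepRing (QpBar p) G) :
    ((detMu hG g x).toMul : (QpBar p)ˣ) = (det g x).toMul := rfl

theorem detMu_mul (hG : IsProPGroup p G) (g h : G) : detMu hG (g * h) = detMu hG g + detMu hG h :=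
  AddMonoidHom.ext fun x => congrArg Additive.ofMul (Subtype.ext
    (congrArg Additive.toMul (det_mul_left g h x)))

theorem detMu_eq_zero_of_mem (hG : IsProPGroup p G) (g : G) {x : RepRing (QpBar p) G}
    (hx : x ∈ gammaFil (QpBar p) G 2) : detMu hG g x = 0 := by
  have := hG.compactSpace
  have := hG.isTopologicalGroup
  exact congrArg Additive.ofMul (Subtype.ext
    (congrArg Additive.toMul (gammaFil_two_le g hx).2 : (det g x).toMul = 1))

theorem detMu_one (hG : IsProPGroup p G) (g : G) : detMu hG g 1 = 0 :=
  congrArg Additive.ofMul (Subtype.ext (congrArg Additive.toMul (det_one g) : (det g 1).toMul = 1))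

theorem detMu_conj (hG : IsProPGroup p G) (g : G) (σ : QpBar p ≃ₐ[ℚ_[p]] QpBar p)
    (x : RepRing (QpBar p) G) :
    (((detMu hG g (conj σ.toRingEquiv x)).toMul : (QpBar p)ˣ) : QpBar p) =
      σ (((detMu hG g x).toMul : (QpBar p)ˣ) : QpBar p) :=
  det_conj σ.toRingEquiv g x

/-- If `detMu g` vanishes on all differences `L - 1` for one-dimensional representations `L`, then
`g` lies in the commutator subgroup. -/
theorem mem_commutator_of_detMu (hG : IsProPGroup p G) (hc : IsClosed (commutator G : Set G)) {g : G}
    (hg : ∀ x : RepRing (QpBar p) G, augmentation x = 0 → detMu hG g x = 0) : g ∈ commutator G := by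
  refine hG.mem_commutator_of_forall_char p hc fun χ hχ => ?_
  have h := hg (lineClass χ hχ - 1) (by rw [map_sub, augmentation_lineClass, map_one, sub_self])
  rw [map_sub, detMu_one, sub_zero] at h
  have h1 : (det g (lineClass χ hχ)).toMul = 1 :=
    congrArg (fun a : Additive (muPInf p) => ((a.toMul : muPInf p) : (QpBar p)ˣ)) h
  rwa [det_lineClass] at h1

/-- A map turning products into sums induces an isomorphism from the abelianization if it is
surjective and vanishes on commutators only. -/
theorem exists_addEquiv_abelianization {G : Type*} [Group G] {A : Type*} [AddCommGroup A] (f : G → A)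
    (hmul : ∀ g h, f (g * h) = f g + f h) (hker : ∀ g, f g = 0 → g ∈ commutator G)
    (hsurj : Function.Surjective f) :
    ∃ e : Additive (Abelianization G) ≃+ A,
      ∀ g, e (Additive.ofMul (Abelianization.of g)) = f g := by
  let F : G →* Multiplicative A := MonoidHom.mk' (fun g => Multiplicative.ofAdd (f g)) hmul
  let φ : Additive (Abelianization G) →+ A := MonoidHom.toAdditiveLeft (Abelianization.lift F)
  have hφ : ∀ g, φ (Additive.ofMul (Abelianization.of g)) = f g := fun g => rfl
  refine ⟨AddEquiv.ofBijective φ ⟨(injective_iff_map_eq_zero φ).2 fun a ha => ?_, fun b => ?_⟩, hφ⟩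
  · obtain ⟨g, hg⟩ := QuotientGroup.mk'_surjective (commutator G) a.toMul
    have ha' : a = Additive.ofMul (Abelianization.of g) := congrArg Additive.ofMul hg.symm
    rw [ha', hφ] at ha
    rw [ha']
    exact congrArg Additive.ofMul ((QuotientGroup.eq_one_iff g).2 (hker g ha))
  · obtain ⟨g, rfl⟩ := hsurj b
    exact ⟨_, hφ g⟩

/-- The homomorphism on `R_G / (ℤ · 1 ⊕ R_{G,2})` induced by the determinant at `g`. -/
def detRep (hG : IsProPGroup p G) (g : G) : galoisHomRep p G :=
  ⟨QuotientAddGroup.lift _ (detMu hG g) (sup_le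
    ((AddSubgroup.zmultiples_le).2 (detMu_one hG g))
    fun _ hx => detMu_eq_zero_of_mem hG g hx),
    fun σ x => detMu_conj hG g σ x⟩

/-- The homomorphism on `I_G / R_{G,2}` induced by the determinant at `g`. -/
def detAug (hG : IsProPGroup p G) (g : G) : galoisHomAug p G :=
  ⟨QuotientAddGroup.lift _
    ((detMu hG g).comp (augIdeal (QpBar p) G).toAddSubgroup.subtype)
    fun _ hx => detMu_eq_zero_of_mem hG g hx,
    fun σ x => detMu_conj hG g σ x⟩

theorem detRep_mk (hG : IsProPGroup p G) (g : G) (x : RepRing (QpBar p) G) :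
    (detRep hG g).1 (QuotientAddGroup.mk x) = detMu hG g x := rfl

theorem detAug_mk (hG : IsProPGroup p G) (g : G) (x : augIdeal (QpBar p) G) :
    (detAug hG g).1 (QuotientAddGroup.mk x) = detMu hG g x := rfl

theorem detRep_mul (hG : IsProPGroup p G) (g h : G) :
    detRep hG (g * h) = detRep hG g + detRep hG h :=
  Subtype.ext (QuotientAddGroup.addMonoidHom_ext _ (detMu_mul hG g h))

theorem detAug_mul (hG : IsProPGroup p G) (g h : G) :
    detAug hG (g * h) = detAug hG g + detAug hG h :=
  Subtype.ext (QuotientAddGroup.addMonoidHom_ext _ (AddMonoidHom.ext fun x =>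
    DFunLike.congr_fun (detMu_mul hG g h) (x : RepRing (QpBar p) G)))

variable (p) in
/-- The inclusion of the `p`-power roots of unity, in additive notation. -/
def muPInfIncl : Additive (muPInf p) →+ Additive (QpBar p)ˣ :=
  MonoidHom.toAdditive (muPInf p).subtype

theorem muPInfIncl_injective : Function.Injective (muPInfIncl p) := Subtype.val_injective

/-- Equivariance is not needed for surjectivity: all homomorphisms come from elements of `G`. -/
theorem detRep_surjective (hG : IsProPGroup p G) : Function.Surjective (detRep hG) := by
  intro f
  have hf : ∀ x ∈ scalarsAddGamma p G, f.1 (QuotientAddGroup.mk x) = 0 := fun x hx => by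
    rw [(QuotientAddGroup.eq_zero_iff x).2 hx, map_zero]
  obtain ⟨g, hg⟩ := hG.exists_eval
    ((muPInfIncl p).comp (f.1.comp (QuotientAddGroup.mk' (scalarsAddGamma p G))))
    (by
      change muPInfIncl p (f.1 (QuotientAddGroup.mk 1)) = 0
      rw [hf 1 (AddSubgroup.mem_sup_left (AddSubgroup.mem_zmultiples 1)), map_zero])
    fun x hx => by
      change muPInfIncl p (f.1 (QuotientAddGroup.mk x)) = 0
      rw [hf x (AddSubgroup.mem_sup_right hx), map_zero]
  exact ⟨g, Subtype.ext (QuotientAddGroup.addMonoidHom_ext _ (AddMonoidHom.ext fun x =>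
    muPInfIncl_injective (hg x).symm))⟩

variable (p G) in
/-- The projection of the representation ring onto the augmentation ideal along `ℤ · 1`. -/
def projAug : RepRing (QpBar p) G →+ augIdeal (QpBar p) G :=
  AddMonoidHom.mk' (fun x => ⟨x - (augmentation x : RepRing (QpBar p) G), by
    change augmentation _ = 0
    rw [map_sub, map_intCast, Int.cast_id, sub_self]⟩) fun x y => Subtype.ext (by
      change x + y - _ = x - _ + (y - _)
      rw [map_add, Int.cast_add]
      ring)

theorem projAug_of_mem {x : RepRing (QpBar p) G} (hx : x ∈ augIdeal (QpBar p) G) :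
    projAug p G x = ⟨x, hx⟩ :=
  Subtype.ext (by
    change x - ((augmentation x : ℤ) : RepRing (QpBar p) G) = x
    rw [show augmentation x = 0 from hx, Int.cast_zero, sub_zero])

theorem detAug_surjective (hG : IsProPGroup p G) : Function.Surjective (detAug hG) := by
  have := hG.compactSpace
  have := hG.isTopologicalGroup
  intro f
  obtain ⟨g, hg⟩ := hG.exists_eval
    ((muPInfIncl p).comp ((f.1.comp (QuotientAddGroup.mk' _)).comp (projAug p G)))
    (by
      have h : projAug p G 1 = 0 := Subtype.ext (by
        change (1 : RepRing (QpBar p) G) - ((augmentation (1 : RepRing (QpBar p) G) : ℤ) :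
          RepRing (QpBar p) G) = 0
        rw [map_one, Int.cast_one, sub_self])
      rw [AddMonoidHom.comp_apply, AddMonoidHom.comp_apply, h, map_zero, map_zero])
    fun x hx => by
      have hx' : x ∈ augIdeal (QpBar p) G := (gammaFil_two_le 1 hx).1
      have h : QuotientAddGroup.mk' ((gammaFil (QpBar p) G 2).addSubgroupOf
          (augIdeal (QpBar p) G).toAddSubgroup) (projAug p G x) = 0 := by
        rw [projAug_of_mem hx']
        exact (QuotientAddGroup.eq_zero_iff _).2 hx
      rw [AddMonoidHom.comp_apply, AddMonoidHom.comp_apply, AddMonoidHom.comp_apply, h, map_zero,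
        map_zero]
  refine ⟨g, Subtype.ext (QuotientAddGroup.addMonoidHom_ext _ (AddMonoidHom.ext fun x =>
    muPInfIncl_injective ?_))⟩
  have h := hg x
  rw [AddMonoidHom.comp_apply, AddMonoidHom.comp_apply, projAug_of_mem x.2] at h
  exact h.symm

end DetHoms

end

theorem mainTheorem8 (p : ℕ) [Fact p.Prime] (hp : p ≠ 2) (d : ℕ) (G : Type*) [Group G]
    [TopologicalSpace G] [ChartedSpace (Fin d → ℚ_[p]) G]
    [LieGroup (modelWithCornersSelf ℚ_[p] (Fin d → ℚ_[p])) ω G] (hG : IsProPGroup p G) :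
    -- the sum of `ℤ · 1` and `R_{G,2}` is direct
    Disjoint (AddSubgroup.zmultiples (1 : RepRing (QpBar p) G))
      (RepRing.gammaFil (QpBar p) G 2) ∧
    -- `DET` induces an isomorphism onto the homomorphisms on `R_G / (ℤ · 1 ⊕ R_{G,2})`
    (∃ e : Additive (Abelianization G) ≃+ galoisHomRep p G,
      ∀ (g : G) (x : RepRing (QpBar p) G),
        (((e (Additive.ofMul (Abelianization.of g))).1 (QuotientAddGroup.mk x)).toMul :
          (QpBar p)ˣ) = (RepRing.det g x).toMul) ∧
    -- `DET` induces an isomorphism onto the homomorphisms on `I_G / R_{G,2}`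
    (∃ e : Additive (Abelianization G) ≃+ galoisHomAug p G,
      ∀ (g : G) (x : RepRing.augIdeal (QpBar p) G),
        (((e (Additive.ofMul (Abelianization.of g))).1 (QuotientAddGroup.mk x)).toMul :
          (QpBar p)ˣ) = (RepRing.det g (x : RepRing (QpBar p) G)).toMul) ∧
    -- `ψ^p` satisfies the character identity which characterizes it
    (∀ (g : G) (x : RepRing (QpBar p) G),
      RepRing.traceHom g (RepRing.adams p x) = RepRing.traceHom (g ^ p) x) ∧
    -- the image of `p - ψ^p`
    (p • AddMonoidHom.id (RepRing (QpBar p) G) - RepRing.adams p).range ≤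
      AddSubgroup.zmultiples (((p : ℤ) - 1) • (1 : RepRing (QpBar p) G)) ⊔
        RepRing.gammaFil (QpBar p) G 2 := by
  have := hG.compactSpace
  have := hG.isTopologicalGroup
  have hp0 : p ≠ 0 := (Fact.out : p.Prime).ne_zero
  have hc : IsClosed (commutator G : Set G) := hG.isClosed_commutator p
    (range_pow_mem_nhds_one (modelWithCornersSelf ℚ_[p] (Fin d → ℚ_[p])) G hp0)
  refine ⟨RepRing.disjoint_zmultiples_gammaFil, ?_, ?_, RepRing.traceHom_adams hp0,
    RepRing.range_nsmul_sub_adams_le hp0⟩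
  · obtain ⟨e, he⟩ := exists_addEquiv_abelianization (detRep hG) (detRep_mul hG)
      (fun g hg => mem_commutator_of_detMu hG hc fun x _ => by
        rw [← detRep_mk, hg]
        rfl) (detRep_surjective hG)
    exact ⟨e, fun g x => by rw [he, detRep_mk, coe_detMu]⟩
  · obtain ⟨e, he⟩ := exists_addEquiv_abelianization (detAug hG) (detAug_mul hG)
      (fun g hg => mem_commutator_of_detMu hG hc fun x hx => by
        have h := detAug_mk hG g ⟨x, hx⟩
        rw [hg] at h
        exact h.symm) (detAug_surjective hG)
    exact ⟨e, fun g x => by rw [he, detAug_mk, coe_detMu]⟩
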